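/- Let $n>1$ be an integer and let $K$ be an infinite field with $\operatorname{char}K=0$ or $\operatorname{char}K>n$. Let the symmetric group $S_n$ act $K$-linearly on the polynomial ring $R=K[x_1,\dots,x_n]$ by $\sigma\cdot f(x_1,\dots,x_n)=f(x_{\sigma(1)},\dots,x_{\sigma(n)})$. For an integer $d\ge 0$ let $R_d$ be the space of homogeneous polynomials of degree $d$ in $R$ (including $0$), regarded as a left module over the group algebra $KS_n$, and let $P(i)$ denote the number of integer partitions of $i$ (so $P(0)=1$). A $KS_n$-module $V$ is called $r$-generated if there are $f_1,\dots,f_r\in V$ (not necessarily distinct) that generate $V$ as a $KS_n$-module. A maximal $r$-generated submodule of $V$ is an $r$-generated submodule of $V$ that is not contained in any other $r$-generated submodule of $V$. Suppose that $n>d$ and $1\le r\le P(d)$, and let $M$ be a maximal $r$-generated $KS_n$-submodule of $R_d$. Then $$\dim_K M=\dim_K R_d-\bigl(P(d)-r\bigr)\quad\text{if and only if}\quad n\ge 1+\frac{\sum_{i=0}^{d-1}P(i)}{r}.$$ -/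

import Mathlib

noncomputable section

/-- The polynomial ring `K[x_1, …, x_n]` as a `K`-linear representation of `S_n`, the permutation
`σ` acting by `f(x_1, …, x_n) ↦ f(x_{σ(1)}, …, x_{σ(n)})`. -/
def polyRep (K : Type*) [Field K] (n : ℕ) :
    Representation K (Equiv.Perm (Fin n)) (MvPolynomial (Fin n) K) where
  toFun σ := (MvPolynomial.rename (R := K) σ).toLinearMap
  map_one' := by
    ext1 m
    ext1
    simp
  map_mul' σ τ := by
    refine LinearMap.ext fun f => ?_
    simp [MvPolynomial.rename_rename]

/-- The restriction of `polyRep` to the space of homogeneous polynomials of degree `d`. -/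
def homogRep (K : Type*) [Field K] (n d : ℕ) :
    Representation K (Equiv.Perm (Fin n)) (MvPolynomial.homogeneousSubmodule (Fin n) K d) where
  toFun σ := (polyRep K n σ).restrict (p := MvPolynomial.homogeneousSubmodule (Fin n) K d)
    (q := MvPolynomial.homogeneousSubmodule (Fin n) K d)
    fun _ hf => MvPolynomial.IsHomogeneous.rename_isHomogeneous hf
  map_one' := by
    refine LinearMap.ext fun f => Subtype.ext ?_
    simp [LinearMap.restrict_apply]
  map_mul' σ τ := by
    refine LinearMap.ext fun f => Subtype.ext ?_
    exact LinearMap.congr_fun ((polyRep K n).map_mul σ τ) f.1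

/-- `R_d`, the degree `d` part of `R = K[x_1, …, x_n]`, as a left module over the group algebra
`K S_n`; its underlying `K`-vector space is `MvPolynomial.homogeneousSubmodule (Fin n) K d`. -/
abbrev HomogPart (K : Type*) [Field K] (n d : ℕ) : Type _ :=
  (homogRep K n d).asModule

/-- A module `V` over a ring `A` is `r`-generated if there are `f_1, …, f_r ∈ V`
(not necessarily distinct) that generate it. -/
def IsRGenerated (A : Type*) [Semiring A] (V : Type*) [AddCommMonoid V] [Module A V] (r : ℕ) : Prop :=
  ∃ f : Fin r → V, Submodule.span A (Set.range f) = ⊤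

/-- `M` is a maximal `r`-generated submodule of `V`: it is an `r`-generated submodule that is not
contained in any other `r`-generated submodule of `V`. -/
def IsMaximalRGenerated {A : Type*} [Semiring A] {V : Type*} [AddCommMonoid V] [Module A V] (r : ℕ)
    (M : Submodule A V) : Prop :=
  IsRGenerated A M r ∧ ∀ N : Submodule A V, IsRGenerated A N r → M ≤ N → N = M

/-- `P(i)`, the number of integer partitions of `i`. -/
def numPartitions (i : ℕ) : ℕ := Fintype.card (Nat.Partition i)

end

/-! Since n! is invertible in K, the group algebra A = KS_n is semisimple, and V = R_d is the direct
sum of the image I and the kernel Z of the averaging idempotent e. As d ≤ n, the monomials of degree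
d form P(d) orbits, so dim I = P(d). Because Ae = Ke, an r-generated submodule meets I in dimension
at most r. Conversely U ⊕ Q, with U ≤ I of dimension at most r and Q ≤ Z r-generated, is again
r-generated, since e separates the sums of generators. Hence a maximal M has dim (M ∩ I) = r, and
the dimension formula holds iff Z is r-generated (`finrank_maximal_iff`).

Necessity: a function c(p, b) of a partition p of d and a part b of p, extended by c(p, 0) = 0,
gives the equivariant map R_d → K^n that sends a monomial with exponents a to the vector (c(type of
a, a_j))_j. Modulo constant vectors the target has dimension n - 1, and on Z the map is determined
by its values at r generators. Independence of these maps yields Σ_p (number of distinct parts of p)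
≤ r(n - 1), and the left side equals Σ_{i<d} P(i) by double counting.

Sufficiency: Z is r-generated once dim Hom(Z, W) ≤ r dim W for every simple W ≤ Z
(`isRGenerated_of_finrank_hom_le`). Such a W has no invariants, and Hom(Z, W) embeds into the sum
over p of the invariants of W under the Young subgroup fixing a monomial of type p. With k distinct
parts this subgroup has k + 1 orbits, as the exponent 0 occurs. The heart of the proof is the bound
(n - 1) dim W^Y ≤ k dim W (`finrank_color_classes`). For two orbits the standard module gives
equality and is split off; on the rest, enough translates of W^Y are independent. More orbits follow
by induction.

The bound fails for S_2 × S_2 on the two-dimensional simple module of S_4, and the induction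
excludes the case of all orbits of size 2. For d < n and at least two orbits that case arises only
for n = 4, d = 2, where adding the contributions of both partitions repairs the estimate. -/

/-! ### Invariants and averages for symmetric groups on subsets. -/

section SwapInvariants

set_option linter.unusedSectionVars false

open Equiv Finset

variable {K α V : Type*} [Field K] [Fintype α] [DecidableEq α] [AddCommGroup V] [Module K V]
  (ρ : Representation K (Perm α) V)

/-- The vectors fixed by all transpositions of two elements of `A`. -/
def swapInv (A : Finset α) : Submodule K V where
  carrier := {w | ∀ x ∈ A, ∀ y ∈ A, ρ (swap x y) w = w}
  zero_mem' := by simp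
  add_mem' := by
    intro a b ha hb x hx y hy
    rw [map_add, ha x hx y hy, hb x hx y hy]
  smul_mem' := by
    intro c a ha x hx y hy
    rw [map_smul, ha x hx y hy]

/-- The subspace `W` is stable under all transpositions of two elements of `S`. -/
def SwapStable (S : Finset α) (W : Submodule K V) : Prop :=
  ∀ x ∈ S, ∀ y ∈ S, ∀ w ∈ W, ρ (swap x y) w ∈ W

/-- The permutations that fix every point outside `A`. -/
def permsOn (A : Finset α) : Finset (Perm α) := univ.filter fun σ => ∀ x ∉ A, σ x = x

/-- The averaging operator over the permutations that fix every point outside `A`. -/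
def swapAvg (A : Finset α) : V →ₗ[K] V :=
  ((permsOn A).card : K)⁻¹ • ∑ σ ∈ permsOn A, ρ σ

theorem mem_permsOn {A : Finset α} {σ : Perm α} : σ ∈ permsOn A ↔ ∀ x ∉ A, σ x = x := by
  simp [permsOn]

theorem swap_mem_permsOn {A : Finset α} {x y : α} (hx : x ∈ A) (hy : y ∈ A) :
    swap x y ∈ permsOn A := by
  rw [mem_permsOn]
  intro z hz
  exact swap_apply_of_ne_of_ne (fun h => hz (h ▸ hx)) (fun h => hz (h ▸ hy))

theorem one_mem_permsOn (A : Finset α) : (1 : Perm α) ∈ permsOn A := by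
  simp [mem_permsOn]

theorem mul_mem_permsOn {A : Finset α} {σ τ : Perm α} (hσ : σ ∈ permsOn A) (hτ : τ ∈ permsOn A) :
    σ * τ ∈ permsOn A := by
  rw [mem_permsOn] at *
  intro x hx
  rw [Perm.mul_apply, hτ x hx, hσ x hx]

theorem permsOn_mono {A B : Finset α} (h : A ⊆ B) {σ : Perm α} (hσ : σ ∈ permsOn A) :
    σ ∈ permsOn B := by
  rw [mem_permsOn] at *
  exact fun x hx => hσ x fun hA => hx (h hA)

theorem apply_mem_of_mem_permsOn {A : Finset α} {σ : Perm α} (hσ : σ ∈ permsOn A) {x : α}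
    (hx : x ∈ A) : σ x ∈ A := by
  rw [mem_permsOn] at hσ
  by_contra h
  exact h (by rw [σ.injective (hσ _ h)]; exact hx)

theorem inv_mem_permsOn {A : Finset α} {σ : Perm α} (hσ : σ ∈ permsOn A) :
    σ⁻¹ ∈ permsOn A := by
  rw [mem_permsOn] at *
  intro x hx
  rw [Perm.inv_eq_iff_eq, hσ x hx]

theorem mem_permsOn_erase {A : Finset α} {σ : Perm α} (hσ : σ ∈ permsOn A) {x : α}
    (hx : σ x = x) : σ ∈ permsOn (A.erase x) := by
  rw [mem_permsOn] at *
  intro y hy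
  by_cases h : y = x
  · rw [h, hx]
  · exact hσ y fun hA => hy (mem_erase.2 ⟨h, hA⟩)

/-- Transpositions of elements of A generate the whole group of permutations supported on A, so
invariance and stability need only be tested on transpositions. -/
theorem permsOn_induction {A : Finset α} {P : Perm α → Prop} (one : P 1)
    (mul : ∀ x ∈ A, ∀ y ∈ A, ∀ τ, P τ → P (swap x y * τ)) {σ : Perm α} (hσ : σ ∈ permsOn A) :
    P σ := by
  rw [mem_permsOn] at hσ
  have h1 : ∀ x, x ∈ A ↔ σ x ∈ A := by
    intro x
    exact ⟨fun hx => apply_mem_of_mem_permsOn (mem_permsOn.2 hσ) hx, fun hx => by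
      by_contra h
      exact h (by rwa [hσ x h] at hx)⟩
  have h2 : ∀ τ : Perm {x // x ∈ A}, P (Perm.ofSubtype τ) := by
    intro τ
    induction τ using Perm.swap_induction_on with
    | one => simpa using one
    | swap_mul f x y hxy ih =>
      rw [map_mul, Perm.ofSubtype_swap_eq]
      exact mul _ x.2 _ y.2 _ ih
  have h3 := Perm.ofSubtype_subtypePerm (f := σ) (p := fun x => x ∈ A) (fun x => (h1 x).symm)
    (fun x hx => by
      by_contra h
      exact hx (hσ x h))
  rw [← h3]
  exact h2 _

theorem apply_eq_of_mem_swapInv {A : Finset α} {w : V} (hw : w ∈ swapInv ρ A) {σ : Perm α}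
    (hσ : σ ∈ permsOn A) : ρ σ w = w := by
  refine permsOn_induction (P := fun σ => ρ σ w = w) (by simp) ?_ hσ
  intro x hx y hy τ h
  rw [map_mul, Module.End.mul_apply, h, hw x hx y hy]

theorem SwapStable.apply_mem {S : Finset α} {W : Submodule K V} (h : SwapStable ρ S W)
    {σ : Perm α} (hσ : σ ∈ permsOn S) {w : V} (hw : w ∈ W) : ρ σ w ∈ W := by
  refine permsOn_induction (P := fun σ => ρ σ w ∈ W) (by simpa) ?_ hσ
  intro x hx y hy τ h'
  rw [map_mul, Module.End.mul_apply]
  exact h x hx y hy _ h'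

theorem SwapStable.mono {S T : Finset α} {W : Submodule K V} (h : SwapStable ρ S W)
    (hT : T ⊆ S) : SwapStable ρ T W := fun x hx y hy => h x (hT hx) y (hT hy)

theorem swapInv_anti {A B : Finset α} (h : A ⊆ B) : swapInv ρ B ≤ swapInv ρ A :=
  fun _ hw x hx y hy => hw x (h hx) y (h hy)

theorem rho_inv_apply (σ : Perm α) (w : V) : ρ σ (ρ σ⁻¹ w) = w := by
  rw [← Module.End.mul_apply, ← map_mul, mul_inv_cancel, map_one, Module.End.one_apply]

@[simp] theorem rho_swap_swap (x y : α) (w : V) : ρ (swap x y) (ρ (swap x y) w) = w := by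
  rw [← Module.End.mul_apply, ← map_mul, swap_mul_self, map_one, Module.End.one_apply]

theorem sum_permsOn_mem_swapInv (A : Finset α) (w : V) :
    ∑ σ ∈ permsOn A, ρ σ w ∈ swapInv ρ A := by
  intro x hx y hy
  rw [map_sum]
  refine sum_nbij' (fun σ => swap x y * σ) (fun σ => swap x y * σ) ?_ ?_ ?_ ?_ ?_
  · exact fun σ hσ => mul_mem_permsOn (swap_mem_permsOn hx hy) hσ
  · exact fun σ hσ => mul_mem_permsOn (swap_mem_permsOn hx hy) hσ
  · intro σ _; simp
  · intro σ _; simp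
  · intro σ _; rw [map_mul, Module.End.mul_apply]

theorem swapAvg_apply (A : Finset α) (w : V) :
    swapAvg ρ A w = ((permsOn A).card : K)⁻¹ • ∑ σ ∈ permsOn A, ρ σ w := by
  simp [swapAvg]

theorem swapAvg_mem_swapInv (A : Finset α) (w : V) : swapAvg ρ A w ∈ swapInv ρ A := by
  rw [swapAvg_apply]
  exact Submodule.smul_mem _ _ (sum_permsOn_mem_swapInv ρ A w)

theorem swapAvg_swap {A : Finset α} {x y : α} (hx : x ∈ A) (hy : y ∈ A) (w : V) :
    swapAvg ρ A (ρ (swap x y) w) = swapAvg ρ A w := by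
  rw [swapAvg_apply, swapAvg_apply]
  congr 1
  refine sum_nbij' (fun σ => σ * swap x y) (fun σ => σ * swap x y) ?_ ?_ ?_ ?_ ?_
  · exact fun σ hσ => mul_mem_permsOn hσ (swap_mem_permsOn hx hy)
  · exact fun σ hσ => mul_mem_permsOn hσ (swap_mem_permsOn hx hy)
  · intro σ _; simp [mul_assoc]
  · intro σ _; simp [mul_assoc]
  · intro σ _; rw [map_mul, Module.End.mul_apply]

theorem rho_swapAvg {A B : Finset α} (g : Perm α) (h : ∀ z, z ∈ A ↔ g z ∈ B) (w : V) :
    ρ g (swapAvg ρ A w) = swapAvg ρ B (ρ g w) := by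
  have h1 : ∀ σ ∈ permsOn A, g * σ * g⁻¹ ∈ permsOn B := by
    intro σ hσ
    rw [mem_permsOn] at *
    intro x hx
    have : g⁻¹ x ∉ A := by rw [h]; simpa using hx
    rw [Perm.mul_apply, Perm.mul_apply, hσ _ this]
    exact g.apply_symm_apply x
  have h2 : ∀ σ ∈ permsOn B, g⁻¹ * σ * g ∈ permsOn A := by
    intro σ hσ
    rw [mem_permsOn] at *
    intro x hx
    rw [h] at hx
    simp [hσ _ hx]
  have hc : (permsOn A).card = (permsOn B).card :=
    card_nbij' (fun σ => g * σ * g⁻¹) (fun σ => g⁻¹ * σ * g) h1 h2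
      (fun σ _ => by simp [mul_assoc]) (fun σ _ => by simp [mul_assoc])
  rw [swapAvg_apply, swapAvg_apply, map_smul, map_sum, hc]
  congr 1
  refine sum_nbij' (fun σ => g * σ * g⁻¹) (fun σ => g⁻¹ * σ * g) h1 h2
      (fun σ _ => by simp [mul_assoc]) (fun σ _ => by simp [mul_assoc]) ?_
  intro σ _
  rw [← Module.End.mul_apply, ← Module.End.mul_apply, ← map_mul, ← map_mul]
  simp

theorem SwapStable.swapAvg_mem {S A : Finset α} {W : Submodule K V} (h : SwapStable ρ S W)
    (hA : A ⊆ S) {w : V} (hw : w ∈ W) : swapAvg ρ A w ∈ W := by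
  rw [swapAvg_apply]
  exact W.smul_mem _ (W.sum_mem fun σ hσ => h.apply_mem ρ (permsOn_mono hA hσ) hw)

/-- By Lagrange the order of this subgroup divides the factorial that is nonzero in K. -/
theorem card_permsOn_ne_zero (hK : ((Fintype.card α).factorial : K) ≠ 0) (A : Finset α) :
    ((permsOn A).card : K) ≠ 0 := by
  let H : Subgroup (Perm α) :=
    { carrier := {σ | σ ∈ permsOn A}
      one_mem' := one_mem_permsOn A
      mul_mem' := mul_mem_permsOn
      inv_mem' := inv_mem_permsOn }
  have h1 : Nat.card H = (permsOn A).card := by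
    have : Nat.card {σ // σ ∈ permsOn A} = (permsOn A).card := by simp
    exact this
  have h2 := Subgroup.card_subgroup_dvd_card H
  rw [h1, Nat.card_eq_fintype_card, Fintype.card_perm] at h2
  intro h0
  obtain ⟨c, hc⟩ := h2
  rw [hc] at hK
  apply hK
  push_cast
  rw [h0, zero_mul]

theorem natCast_ne_zero_of_le_card (hK : ((Fintype.card α).factorial : K) ≠ 0) {a : ℕ}
    (h0 : a ≠ 0) (ha : a ≤ Fintype.card α) : (a : K) ≠ 0 := by
  intro h
  obtain ⟨c, hc⟩ := Nat.dvd_factorial (Nat.pos_of_ne_zero h0) ha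
  rw [hc] at hK
  apply hK
  push_cast
  rw [h, zero_mul]

theorem swapAvg_eq_self (hK : ((Fintype.card α).factorial : K) ≠ 0) {A : Finset α} {w : V}
    (hw : w ∈ swapInv ρ A) : swapAvg ρ A w = w := by
  rw [swapAvg_apply, sum_congr rfl fun σ hσ => apply_eq_of_mem_swapInv ρ hw hσ, sum_const,
    ← Nat.cast_smul_eq_nsmul K, smul_smul, inv_mul_cancel₀ (card_permsOn_ne_zero hK A), one_smul]

theorem swap_mem_iff {S : Finset α} {x y : α} (hx : x ∈ S) (hy : y ∈ S) (z : α) :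
    swap x y z ∈ S ↔ z ∈ S := by
  rw [swap_apply_def]
  split_ifs with h1 h2
  · simp [h1, hx, hy]
  · simp [h2, hx, hy]
  · rfl

theorem rho_swap_swapAvg_erase {S : Finset α} {p q : α} (hp : p ∈ S) (hq : q ∈ S) (y : α)
    (w : V) : ρ (swap p q) (swapAvg ρ (S.erase y) w)
      = swapAvg ρ (S.erase (swap p q y)) (ρ (swap p q) w) := by
  refine rho_swapAvg ρ _ (fun z => ?_) w
  rw [mem_erase, mem_erase, swap_mem_iff hp hq, (swap p q).injective.ne_iff]

/-- The translates of u by (x z) correspond to the cosets of the stabilizer of x, so permutations of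
S move them in the way they move the points z. -/
theorem rho_swap_rho_swap {S : Finset α} {x p q z : α} (hx : x ∈ S) (hp : p ∈ S) (hq : q ∈ S)
    (hz : z ∈ S) {u : V} (hu : u ∈ swapInv ρ (S.erase x)) :
    ρ (swap p q) (ρ (swap x z) u) = ρ (swap x (swap p q z)) u := by
  have h1 : swap x (swap p q z) * swap p q * swap x z ∈ permsOn (S.erase x) := by
    apply mem_permsOn_erase
    · exact mul_mem_permsOn (mul_mem_permsOn (swap_mem_permsOn hx ((swap_mem_iff hp hq z).2 hz))
        (swap_mem_permsOn hp hq)) (swap_mem_permsOn hx hz)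
    · simp
  have h2 := apply_eq_of_mem_swapInv ρ hu h1
  rw [map_mul, map_mul, Module.End.mul_apply, Module.End.mul_apply] at h2
  conv_rhs => rw [← h2]
  simp

theorem rho_swap_mem_swapInv_erase {S : Finset α} {x z : α} (hx : x ∈ S) (hz : z ∈ S) {u : V}
    (hu : u ∈ swapInv ρ (S.erase x)) : ρ (swap x z) u ∈ swapInv ρ (S.erase z) := by
  intro p hp q hq
  rw [mem_erase] at hp hq
  rw [rho_swap_rho_swap ρ hx hp.2 hq.2 hz hu, swap_apply_of_ne_of_ne hp.1.symm hq.1.symm]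

theorem sum_swap_mem_swapInv {S : Finset α} {x : α} (hx : x ∈ S) {u : V}
    (hu : u ∈ swapInv ρ (S.erase x)) : ∑ z ∈ S, ρ (swap x z) u ∈ swapInv ρ S := by
  intro p hp q hq
  rw [map_sum]
  refine sum_nbij' (swap p q) (swap p q) ?_ ?_ ?_ ?_ ?_
  · exact fun z hz => (swap_mem_iff hp hq z).2 hz
  · exact fun z hz => (swap_mem_iff hp hq z).2 hz
  · simp
  · simp
  · exact fun z hz => rho_swap_rho_swap ρ hx hp hq hz hu

/-- The sum of all translates (x z)u is S-invariant, hence zero. Averaging it over the stabilizer of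
y fixes the term z = y and turns the other |S| - 1 terms into the average of u. -/
theorem swapAvg_erase_of_mem (hK : ((Fintype.card α).factorial : K) ≠ 0) {S : Finset α}
    {W : Submodule K V} (hW : SwapStable ρ S W) (h0 : W ⊓ swapInv ρ S = ⊥) {x y : α} (hx : x ∈ S)
    (hy : y ∈ S) (hxy : x ≠ y) {u : V} (huW : u ∈ W) (hu : u ∈ swapInv ρ (S.erase x)) :
    ((S.card : K) - 1) • swapAvg ρ (S.erase y) u = -ρ (swap x y) u := by
  have h1 : ∑ z ∈ S, ρ (swap x z) u = 0 := by
    have : ∑ z ∈ S, ρ (swap x z) u ∈ W ⊓ swapInv ρ S :=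
      ⟨W.sum_mem fun z hz => hW x hx z hz u huW, sum_swap_mem_swapInv ρ hx hu⟩
    rwa [h0, Submodule.mem_bot] at this
  have h2 := congrArg (swapAvg ρ (S.erase y)) h1
  rw [map_sum, map_zero, ← add_sum_erase _ _ hy,
    swapAvg_eq_self ρ hK (rho_swap_mem_swapInv_erase ρ hx hy hu),
    sum_congr rfl fun z hz => swapAvg_swap ρ (mem_erase.2 ⟨hxy, hx⟩) hz u, sum_const,
    card_erase_of_mem hy, ← Nat.cast_smul_eq_nsmul K, Nat.cast_pred (card_pos.2 ⟨y, hy⟩)] at h2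
  exact eq_neg_of_add_eq_zero_right h2

/-- Every permutation of S is uniquely h(x z) with h fixing x and z the preimage of x, so the sum is
a multiple of the sum over the whole group. -/
theorem sum_swap_swapAvg_erase_mem {S : Finset α} {x : α} (hx : x ∈ S) (w : V) :
    ∑ z ∈ S, ρ (swap x z) (swapAvg ρ (S.erase z) w) ∈ swapInv ρ S := by
  have h1 : ∑ z ∈ S, ρ (swap x z) (swapAvg ρ (S.erase z) w)
      = ((permsOn (S.erase x)).card : K)⁻¹ • ∑ σ ∈ permsOn S, ρ σ w := by
    rw [sum_congr rfl fun z hz => rho_swap_swapAvg_erase ρ hx hz z w]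
    simp only [swap_apply_right, swapAvg_apply]
    rw [← smul_sum]
    congr 1
    rw [← sum_product']
    refine sum_nbij' (fun p => p.2 * swap x p.1) (fun σ => (σ⁻¹ x, σ * swap x (σ⁻¹ x)))
      ?_ ?_ ?_ ?_ ?_
    · rintro ⟨z, h⟩ hp
      rw [mem_product] at hp
      exact mul_mem_permsOn (permsOn_mono (erase_subset _ _) hp.2) (swap_mem_permsOn hx hp.1)
    · intro σ hσ
      have : σ⁻¹ x ∈ S := apply_mem_of_mem_permsOn (inv_mem_permsOn hσ) hx
      rw [mem_product]
      refine ⟨this, mem_permsOn_erase (mul_mem_permsOn hσ (swap_mem_permsOn hx this)) ?_⟩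
      simp
    · rintro ⟨z, h⟩ hp
      rw [mem_product] at hp
      have h2 : h⁻¹ x = x :=
        mem_permsOn.1 (inv_mem_permsOn hp.2) x (notMem_erase x S)
      have h3 : (Equiv.symm h) x = x := h2
      simp [h3, mul_assoc]
    · intro σ _
      simp [mul_assoc]
    · rintro ⟨z, h⟩ _
      rw [map_mul, Module.End.mul_apply]
  rw [h1]
  exact Submodule.smul_mem _ _ (sum_permsOn_mem_swapInv ρ S w)

end SwapInvariants

/-! ### Splitting off the standard module. -/

section StandardPart

open Equiv Finset Module

set_option linter.unusedSectionVars false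

variable {K α V : Type*} [Field K] [Fintype α] [DecidableEq α] [AddCommGroup V] [Module K V]
  (ρ : Representation K (Perm α) V)

theorem finrank_le_add_of_map_le [FiniteDimensional K V] {P T Q : Submodule K V} (g : V →ₗ[K] V)
    (h1 : ∀ w ∈ P, g w ∈ T) (h2 : ∀ w ∈ P, g w = 0 → w ∈ Q) :
    finrank K P ≤ finrank K T + finrank K Q := by
  let g' : P →ₗ[K] T := (g.comp P.subtype).codRestrict T fun w => h1 w w.2
  have h3 := LinearMap.finrank_range_add_finrank_ker g'
  have h4 : finrank K (LinearMap.range g') ≤ finrank K T := Submodule.finrank_le _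
  have h5 : finrank K (LinearMap.ker g') ≤ finrank K Q := by
    let k : LinearMap.ker g' →ₗ[K] Q :=
      (P.subtype.comp (LinearMap.ker g').subtype).codRestrict Q fun w => by
        refine h2 _ w.1.2 ?_
        have := congrArg Subtype.val (LinearMap.mem_ker.1 w.2)
        exact this
    refine LinearMap.finrank_le_finrank_of_injective (f := k) ?_
    intro a b hab
    have := congrArg Subtype.val hab
    exact Subtype.ext (Subtype.ext this)
  omega

/-- The vectors of `W` killed by all averaging operators over the point stabilizers in `S`. -/
def nonstdPart (S : Finset α) (W : Submodule K V) : Submodule K V where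
  carrier := {w | w ∈ W ∧ ∀ y ∈ S, swapAvg ρ (S.erase y) w = 0}
  zero_mem' := ⟨W.zero_mem, by simp⟩
  add_mem' := fun ha hb => ⟨W.add_mem ha.1 hb.1, fun y hy => by
    rw [map_add, ha.2 y hy, hb.2 y hy, add_zero]⟩
  smul_mem' := fun c _ ha => ⟨W.smul_mem c ha.1, fun y hy => by
    rw [map_smul, ha.2 y hy, smul_zero]⟩

theorem swapStable_nonstdPart {S : Finset α} {W : Submodule K V} (hW : SwapStable ρ S W) :
    SwapStable ρ S (nonstdPart ρ S W) := by
  intro p hp q hq w hw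
  refine ⟨hW p hp q hq w hw.1, fun y hy => ?_⟩
  have h1 := rho_swap_swapAvg_erase ρ hp hq (swap p q y) w
  rw [swap_apply_self, hw.2 _ ((swap_mem_iff hp hq y).2 hy), map_zero] at h1
  exact h1.symm

theorem nonstdPart_inf_swapInv_erase (hK : ((Fintype.card α).factorial : K) ≠ 0) {S : Finset α}
    {W : Submodule K V} {x : α} (hx : x ∈ S) {w : V} (hw : w ∈ nonstdPart ρ S W)
    (h : w ∈ swapInv ρ (S.erase x)) : w = 0 := by
  rw [← swapAvg_eq_self ρ hK h, hw.2 x hx]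

/-- A vector fixed by the stabilizer of x generates copies of the standard module. Its translates by
(x z) with z ≠ x are independent of each other and of the nonstandard part. -/
theorem finrank_nonstdPart_add_le [FiniteDimensional K V]
    (hK : ((Fintype.card α).factorial : K) ≠ 0) {S : Finset α}
    {W : Submodule K V} (hW : SwapStable ρ S W) (h0 : W ⊓ swapInv ρ S = ⊥) {x : α} (hx : x ∈ S) :
    finrank K (nonstdPart ρ S W)
      + (S.card - 1) * finrank K (W ⊓ swapInv ρ (S.erase x) : Submodule K V) ≤ finrank K W := by
  set T : Submodule K V := W ⊓ swapInv ρ (S.erase x) with hT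
  set Q := nonstdPart ρ S W with hQ
  let Φ : (Q × (S.erase x → T)) →ₗ[K] V :=
    Q.subtype.comp (LinearMap.fst K _ _) +
      ∑ z : S.erase x, (ρ (swap x z)).comp
        (T.subtype.comp ((LinearMap.proj z).comp (LinearMap.snd K _ _)))
  have hΦ : ∀ p, Φ p = (p.1 : V) + ∑ z : S.erase x, ρ (swap x z) (p.2 z : V) := by
    intro p
    simp [Φ]
  have hmem : ∀ p, Φ p ∈ W := by
    intro p
    rw [hΦ]
    exact W.add_mem p.1.2.1 (W.sum_mem fun z _ =>
      hW x hx z (mem_of_mem_erase z.2) _ (p.2 z).2.1)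
  have hn : (S.card : K) ≠ 0 :=
    natCast_ne_zero_of_le_card hK (card_pos.2 ⟨x, hx⟩).ne' (card_le_univ S)
  have hinj : Function.Injective (Φ.codRestrict W hmem) := by
    rw [← LinearMap.ker_eq_bot, LinearMap.ker_codRestrict, LinearMap.ker_eq_bot']
    rintro ⟨q, u⟩ hp
    rw [hΦ] at hp
    simp only at hp
    -- Averaging the relation over the stabilizer of y kills q and leaves (|S| - 1) u_y equal to the
    -- sum of the other u_z. Summing over the |S| - 1 points y then forces the total to vanish.
    have key : ∀ y : S.erase x, (S.card : K) • (u y : V) = ∑ z, (u z : V) := by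
      intro y
      have hy := mem_of_mem_erase y.2
      have h1 := congrArg (fun v => ((S.card : K) - 1) • swapAvg ρ (S.erase y) v) hp
      simp only [map_add, map_sum, map_zero, smul_zero, smul_add, smul_sum] at h1
      rw [q.2.2 y hy, smul_zero, zero_add, ← add_sum_erase _ _ (mem_univ y),
        swapAvg_eq_self ρ hK (rho_swap_mem_swapInv_erase ρ hx hy (u y).2.2)] at h1
      have h2 : ∀ z ∈ univ.erase y, ((S.card : K) - 1) •
          swapAvg ρ (S.erase y) (ρ (swap x z) (u z : V)) = -ρ (swap x y) (u z : V) := by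
        intro z hz
        have hz' := mem_of_mem_erase z.2
        have hzy : (z : α) ≠ y := fun h => (mem_erase.1 hz).1 (Subtype.ext h)
        rw [swapAvg_erase_of_mem ρ hK hW h0 hz' hy hzy (hW x hx z hz' _ (u z).2.1)
          (rho_swap_mem_swapInv_erase ρ hx hz' (u z).2.2),
          rho_swap_rho_swap ρ hx hz' hy hz' (u z).2.2, swap_apply_left]
      rw [sum_congr rfl h2, sum_neg_distrib, ← map_sum, ← map_smul, ← sub_eq_add_neg,
        ← map_sub] at h1
      have h3 := congrArg (ρ (swap x y)) h1
      rw [rho_swap_swap, map_zero, sub_smul, one_smul, sub_eq_zero] at h3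
      rw [← add_sum_erase _ _ (mem_univ y), ← h3]
      abel
    have hsum : ∑ z, (u z : V) = 0 := by
      have h1 : (S.card : K) • ∑ z, (u z : V) = ((S.card : K) - 1) • ∑ z, (u z : V) := by
        rw [smul_sum, sum_congr rfl fun z _ => key z, sum_const, card_univ,
          Fintype.card_coe, card_erase_of_mem hx, ← Nat.cast_smul_eq_nsmul K,
          Nat.cast_pred (card_pos.2 ⟨x, hx⟩)]
      rw [sub_smul, one_smul] at h1
      exact sub_eq_self.1 h1.symm
    have hu : ∀ z, u z = 0 := by
      intro z
      have := key z
      rw [hsum] at this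
      exact Subtype.ext ((smul_eq_zero.1 this).resolve_left hn)
    refine Prod.ext (Subtype.ext ?_) (funext hu)
    simpa [hu] using hp
  have h := LinearMap.finrank_le_finrank_of_injective hinj
  rwa [finrank_prod, finrank_pi_fintype, sum_const, card_univ, Fintype.card_coe,
    card_erase_of_mem hx, smul_eq_mul] at h

/-- The standard module has a single invariant line under S_A × S_B, detected by averaging over the
stabilizer of one x in A. If that average vanishes, then so do those at all points of S, first on A
by symmetry and then on B. -/
theorem finrank_inf_swapInv_le [FiniteDimensional K V]
    (hK : ((Fintype.card α).factorial : K) ≠ 0) {S A B : Finset α}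
    {W : Submodule K V} (hW : SwapStable ρ S W) (h0 : W ⊓ swapInv ρ S = ⊥)
    (hAB : Disjoint A B) (hS : A ∪ B = S) {x : α} (hx : x ∈ A) (hB : B.Nonempty) :
    finrank K (W ⊓ swapInv ρ A ⊓ swapInv ρ B : Submodule K V)
      ≤ finrank K (W ⊓ swapInv ρ (S.erase x) : Submodule K V)
        + finrank K (nonstdPart ρ S W ⊓ swapInv ρ A ⊓ swapInv ρ B : Submodule K V) := by
  have hA' : ∀ z ∈ A, z ∈ S := fun z hz => hS ▸ mem_union_left _ hz
  have hB' : ∀ z ∈ B, z ∈ S := fun z hz => hS ▸ mem_union_right _ hz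
  refine finrank_le_add_of_map_le (swapAvg ρ (S.erase x)) ?_ ?_
  · exact fun w hw => ⟨hW.swapAvg_mem ρ (erase_subset _ _) hw.1.1, swapAvg_mem_swapInv ρ _ w⟩
  · rintro w ⟨⟨hwW, hwA⟩, hwB⟩ hw
    refine ⟨⟨⟨hwW, ?_⟩, hwA⟩, hwB⟩
    have h1 : ∀ y ∈ A, swapAvg ρ (S.erase y) w = 0 := by
      intro y hy
      have := rho_swap_swapAvg_erase ρ (hA' x hx) (hA' y hy) x w
      rwa [hw, map_zero, swap_apply_left, hwA x hx y hy, eq_comm] at this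
    intro y hy
    rw [← hS, mem_union] at hy
    rcases hy with hy | hy
    · exact h1 y hy
    have hyS := hB' y hy
    set u := swapAvg ρ (S.erase y) w with hu
    have huI : u ∈ swapInv ρ (S.erase y) := swapAvg_mem_swapInv ρ _ w
    have h2 : ∀ z ∈ B, swapAvg ρ (S.erase z) w = ρ (swap y z) u := by
      intro z hz
      rw [hu, rho_swap_swapAvg_erase ρ hyS (hB' z hz), swap_apply_left, hwB y hy z hz]
    have h3 : ∑ z ∈ S, ρ (swap x z) (swapAvg ρ (S.erase z) w) = 0 := by
      have : ∑ z ∈ S, ρ (swap x z) (swapAvg ρ (S.erase z) w) ∈ W ⊓ swapInv ρ S :=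
        ⟨W.sum_mem fun z hz => hW x (hA' x hx) z hz _ (hW.swapAvg_mem ρ (erase_subset _ _) hwW),
          sum_swap_swapAvg_erase_mem ρ (hA' x hx) w⟩
      rwa [h0, Submodule.mem_bot] at this
    have hsplit : ∀ F : α → V, ∑ z ∈ S, F z = ∑ z ∈ A, F z + ∑ z ∈ B, F z := fun F => by
      rw [← hS, sum_union hAB]
    rw [hsplit, sum_eq_zero fun z hz => by rw [h1 z hz, map_zero], zero_add] at h3
    -- By B-invariance the averages at the points of B are translates of one vector u, so their
    -- contributions coincide and the relation becomes |B| times one translate of u.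
    have h4 : ∀ z ∈ B, ρ (swap x z) (swapAvg ρ (S.erase z) w) = ρ (swap y x) u := by
      intro z hz
      rw [h2 z hz, swap_comm x z, rho_swap_rho_swap ρ hyS (hB' z hz) (hA' x hx) (hB' z hz) huI,
        swap_apply_left]
    rw [sum_congr rfl h4, sum_const, ← Nat.cast_smul_eq_nsmul K] at h3
    have h5 := (smul_eq_zero.1 h3).resolve_left
      (natCast_ne_zero_of_le_card hK (card_pos.2 hB).ne' (card_le_univ B))
    have h6 := congrArg (ρ (swap y x)) h5
    rwa [rho_swap_swap, map_zero] at h6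

end StandardPart

/-! ### Independent translates of the invariants of two classes. -/

section Independence

open Equiv Finset Module

set_option linter.unusedSectionVars false

variable {K α V : Type*} [Field K] [Fintype α] [DecidableEq α] [AddCommGroup V] [Module K V]
  (ρ : Representation K (Perm α) V)

theorem rho_conj_swap (g : Perm α) (r s : α) (w : V) :
    ρ g (ρ (swap r s) w) = ρ (swap (g r) (g s)) (ρ g w) := by
  rw [← Module.End.mul_apply, ← Module.End.mul_apply, ← map_mul, ← map_mul,
    mul_swap_eq_swap_mul]

theorem rho_swap_comm_of_ne {p q r s : α} (h1 : p ≠ r) (h2 : p ≠ s) (h3 : q ≠ r) (h4 : q ≠ s)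
    (w : V) : ρ (swap p q) (ρ (swap r s) w) = ρ (swap r s) (ρ (swap p q) w) := by
  rw [rho_conj_swap, swap_apply_of_ne_of_ne h1.symm h3.symm,
      swap_apply_of_ne_of_ne h2.symm h4.symm]

theorem rho_swap_self (x : α) (w : V) : ρ (swap x x) w = w := by
  rw [swap_self]
  exact congrArg (fun f => f w) (map_one ρ)

theorem mem_swapInv_of_swap_fixed {A B : Finset α} {w : V} (hA : w ∈ swapInv ρ A)
    (hB : w ∈ swapInv ρ B) {x y : α} (hx : x ∈ A) (hy : y ∈ B) (h : ρ (swap x y) w = w) :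
    w ∈ swapInv ρ (A ∪ B) := by
  have h1 : ∀ z ∈ A ∪ B, ρ (swap x z) w = w := by
    intro z hz
    rcases mem_union.1 hz with hz | hz
    · exact hA x hx z hz
    · by_cases hzx : z = x
      · rw [hzx, rho_swap_self]
      by_cases hyx : y = x
      · exact hB x (hyx ▸ hy) z hz
      have := rho_conj_swap ρ (swap y z) x y w
      rw [h, hB y hy z hz, swap_apply_left, swap_apply_of_ne_of_ne (Ne.symm hyx) (Ne.symm hzx)]
        at this
      exact this.symm
  intro p hp q hq
  by_cases hqp : q = p
  · rw [hqp, rho_swap_self]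
  by_cases hqx : q = x
  · rw [hqx, swap_comm]; exact h1 p hp
  have := rho_conj_swap ρ (swap x p) x q w
  rw [h1 q hq, h1 p hp, swap_apply_left, swap_apply_of_ne_of_ne hqx hqp] at this
  exact this.symm

theorem rho_swap_swap_of_fixed {x y z : α} (hzx : z ≠ x) (hyz : y ≠ z) {v : V}
    (hv : ρ (swap x z) v = v) : ρ (swap y z) (ρ (swap x y) v) = ρ (swap x y) v := by
  have h := rho_conj_swap ρ (swap x y) x z v
  rw [hv, swap_apply_left, swap_apply_of_ne_of_ne hzx hyz.symm] at h
  exact h.symm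

/-- If two disjoint transpositions across `A` and `B` satisfy the relation
`(1 - (z w)) (1 - (x y)) v = 0`, and there are no invariants of the stabilizer of `x`,
then `v = 0`. -/
theorem eq_zero_of_swap_relation {A B : Finset α} (hAB : Disjoint A B) {W : Submodule K V}
    (hW : SwapStable ρ (A ∪ B) W) {x y z w : α} (hx : x ∈ A) (hz : z ∈ A) (hxz : z ≠ x)
    (hy : y ∈ B) (hw : w ∈ B) (hyw : w ≠ y) (hn : ((A ∪ B).card : K) ≠ 0)
    (h0 : ∀ u ∈ W, u ∈ swapInv ρ ((A ∪ B).erase x) → u = 0) {v : V} (hvW : v ∈ W)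
    (hvA : v ∈ swapInv ρ A) (hvB : v ∈ swapInv ρ B)
    (hrel : ρ (swap z w) (v - ρ (swap x y) v) = v - ρ (swap x y) v) : v = 0 := by
  have hne : ∀ p ∈ A, ∀ q ∈ B, p ≠ q := fun p hp q hq h => disjoint_left.1 hAB hp (h ▸ hq)
  have hxS : x ∈ A ∪ B := mem_union_left _ hx
  have hyS : y ∈ A ∪ B := mem_union_right _ hy
  have hyx : y ≠ x := (hne x hx y hy).symm
  set g := v - ρ (swap x y) v with hg
  have hgW : g ∈ W := W.sub_mem hvW (hW x hxS y hyS v hvW)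
  have hgA : g ∈ swapInv ρ (A.erase x) := by
    intro p hp q hq
    rw [mem_erase] at hp hq
    rw [hg, map_sub, rho_swap_comm_of_ne ρ hp.1 (hne p hp.2 y hy) hq.1 (hne q hq.2 y hy),
      hvA p hp.2 q hq.2]
  have hgB : g ∈ swapInv ρ (B.erase y) := by
    intro p hp q hq
    rw [mem_erase] at hp hq
    rw [hg, map_sub, rho_swap_comm_of_ne ρ (hne x hx p hp.2).symm hp.1 (hne x hx q hq.2).symm
      hq.1, hvB p hp.2 q hq.2]
  have hset : ((A ∪ B).erase x).erase y = A.erase x ∪ B.erase y := by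
    ext p
    simp only [mem_erase, mem_union]
    constructor
    · rintro ⟨h1, h2, h3 | h3⟩
      · exact Or.inl ⟨h2, h3⟩
      · exact Or.inr ⟨h1, h3⟩
    · rintro (⟨h1, h2⟩ | ⟨h1, h2⟩)
      · exact ⟨hne p h2 y hy, h1, Or.inl h2⟩
      · exact ⟨h1, (hne x hx p h2).symm, Or.inr h2⟩
  -- The relation says that (z w) fixes g, and this transposition links the two remaining classes.
  have hgI : g ∈ swapInv ρ (((A ∪ B).erase x).erase y) := by
    rw [hset]
    exact mem_swapInv_of_swap_fixed ρ hgA hgB (mem_erase.2 ⟨hxz, hz⟩) (mem_erase.2 ⟨hyw, hw⟩) hrel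
  have hyS' : y ∈ (A ∪ B).erase x := mem_erase.2 ⟨hyx, hyS⟩
  have hsum : ∑ p ∈ (A ∪ B).erase x, ρ (swap y p) g = 0 :=
    h0 _ (W.sum_mem fun p hp => hW y hyS p (mem_of_mem_erase hp) g hgW)
      (sum_swap_mem_swapInv ρ hyS' hgI)
  -- Applying 1 - (x y) to this sum turns each term with p ≠ y into g, while p = y gives 2g.
  -- Altogether |S| g = 0, so (x y) fixes v and v is invariant under everything.
  have hsum2 : ∑ p ∈ (A ∪ B).erase x, (ρ (swap y p) g - ρ (swap x y) (ρ (swap y p) g)) = 0 := by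
    rw [sum_sub_distrib, ← map_sum, hsum, map_zero, sub_zero]
  have hterm : ∀ p ∈ ((A ∪ B).erase x).erase y,
      ρ (swap y p) g - ρ (swap x y) (ρ (swap y p) g) = g := by
    intro p hp
    rw [hset, mem_union, mem_erase, mem_erase] at hp
    rcases hp with ⟨hpx, hp⟩ | ⟨hpy, hp⟩
    · have hyp : y ≠ p := (hne p hp y hy).symm
      have e1 : ρ (swap y p) (ρ (swap x y) v) = ρ (swap x y) v :=
        rho_swap_swap_of_fixed ρ hpx hyp (hvA x hx p hp)
      have e2 : ρ (swap x y) (ρ (swap y p) v) = ρ (swap y p) v := by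
        have := rho_swap_swap_of_fixed ρ hpx.symm hyx (hvA p hp x hx)
        rwa [swap_comm y x, swap_comm p y] at this
      rw [hg, map_sub, e1, map_sub, e2, rho_swap_swap]
      abel
    · have hpx : p ≠ x := (hne x hx p hp).symm
      have e1 : ρ (swap y p) (ρ (swap x y) v) = ρ (swap x p) v := by
        rw [rho_conj_swap, hvB y hy p hp, swap_apply_left,
          swap_apply_of_ne_of_ne hyx.symm hpx.symm]
      have e2 : ρ (swap x y) (ρ (swap x p) v) = ρ (swap x p) v := by
        rw [rho_conj_swap, swap_apply_left, swap_apply_of_ne_of_ne hpx hpy, e1]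
      rw [hg, map_sub, e1, hvB y hy p hp, map_sub, e2]
      abel
  have hcard : (((A ∪ B).erase x).erase y).card + 2 = (A ∪ B).card := by
    have h1 := card_erase_add_one hyS'
    have h2 := card_erase_add_one hxS
    omega
  have hgg : ρ (swap x y) g = -g := by
    rw [hg, map_sub, rho_swap_swap]
    abel
  rw [← add_sum_erase _ _ hyS', sum_congr rfl hterm, sum_const, rho_swap_self, hgg,
    ← Nat.cast_smul_eq_nsmul K] at hsum2
  have hng : ((A ∪ B).card : K) • g = 0 := by
    rw [← hcard, ← hsum2]
    push_cast
    module
  have hg0 := (smul_eq_zero.1 hng).resolve_left hn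
  have hvx : ρ (swap x y) v = v := by
    rw [hg, sub_eq_zero] at hg0
    exact hg0.symm
  exact h0 v hvW (swapInv_anti ρ (erase_subset _ _)
    (mem_swapInv_of_swap_fixed ρ hvA hvB hx hy hvx))

/-- The operator `1 - (x y)`. -/
def swapDiff (x y : α) : V →ₗ[K] V := LinearMap.id - ρ (swap x y)

theorem swapDiff_apply (x y : α) (w : V) : swapDiff ρ x y w = w - ρ (swap x y) w := rfl

theorem swapDiff_rho (g : Perm α) (x y : α) (w : V) :
    swapDiff ρ (g x) (g y) (ρ g w) = ρ g (swapDiff ρ x y w) := by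
  rw [swapDiff_apply, swapDiff_apply, map_sub, rho_conj_swap]

theorem swapDiff_comm {p q r s : α} (h1 : p ≠ r) (h2 : p ≠ s) (h3 : q ≠ r) (h4 : q ≠ s) (w : V) :
    swapDiff ρ p q (swapDiff ρ r s w) = swapDiff ρ r s (swapDiff ρ p q w) := by
  simp only [swapDiff_apply, map_sub, rho_swap_comm_of_ne ρ h1 h2 h3 h4]
  abel

theorem swapDiff_eq_zero {A : Finset α} {w : V} (hw : w ∈ swapInv ρ A) {x y : α} (hx : x ∈ A)
    (hy : y ∈ A) : swapDiff ρ x y w = 0 := by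
  rw [swapDiff_apply, hw x hx y hy, sub_self]

theorem swapDiff_rho_eq_zero {A : Finset α} {w : V} (hw : w ∈ swapInv ρ A) {x y : α} (g : Perm α)
    (hx : g⁻¹ x ∈ A) (hy : g⁻¹ y ∈ A) : swapDiff ρ x y (ρ g w) = 0 := by
  have h := swapDiff_rho ρ g (g⁻¹ x) (g⁻¹ y) w
  rw [swapDiff_eq_zero ρ hw hx hy, map_zero] at h
  have e : ∀ z, g (g⁻¹ z) = z := fun z => g.apply_symm_apply z
  rwa [e, e] at h

theorem swapDiff_rho_swap_eq_zero {A : Finset α} {w : V} (hw : w ∈ swapInv ρ A) {x y p q : α}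
    (hx : x ∈ A) (hy : y ∈ A) (h1 : x ≠ p) (h2 : x ≠ q) (h3 : y ≠ p) (h4 : y ≠ q) :
    swapDiff ρ x y (ρ (swap p q) w) = 0 := by
  apply swapDiff_rho_eq_zero ρ hw
  · rwa [swap_inv, swap_apply_of_ne_of_ne h1 h2]
  · rwa [swap_inv, swap_apply_of_ne_of_ne h3 h4]

variable {ρ} in
theorem eq_zero_of_swapDiff {A B : Finset α} (hAB : Disjoint A B) {W : Submodule K V}
    (hW : SwapStable ρ (A ∪ B) W) (hn : ((A ∪ B).card : K) ≠ 0)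
    (h0 : ∀ x ∈ A ∪ B, ∀ u ∈ W, u ∈ swapInv ρ ((A ∪ B).erase x) → u = 0)
    {x y z w : α} (hx : x ∈ A) (hz : z ∈ A) (hxz : z ≠ x)
    (hy : y ∈ B) (hw : w ∈ B) (hyw : w ≠ y) {v : V}
    (hv : v ∈ W ⊓ swapInv ρ A ⊓ swapInv ρ B)
    (hrel : swapDiff ρ z w (swapDiff ρ x y v) = 0) : v = 0 := by
  refine eq_zero_of_swap_relation ρ hAB hW hx hz hxz hy hw hyw hn (h0 x (mem_union_left _ hx))
    hv.1.1 hv.1.2 hv.2 ?_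
  rw [swapDiff_apply, sub_eq_zero] at hrel
  exact hrel.symm

-- The operator (1 - (j j₀))(1 - (i i₀)) kills v and every translate other than the one at (i, j).
-- Conjugated by (i j), it becomes a product of two disjoint differences across A and B, which is
-- injective on the invariants by `eq_zero_of_swapDiff`.
variable {ρ} in
theorem eq_zero_of_sum_rho_swap {A B : Finset α} (hAB : Disjoint A B) {W : Submodule K V}
    (hW : SwapStable ρ (A ∪ B) W) (hn : ((A ∪ B).card : K) ≠ 0)
    (h0 : ∀ x ∈ A ∪ B, ∀ u ∈ W, u ∈ swapInv ρ ((A ∪ B).erase x) → u = 0)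
    {i₀ j₀ : α} (hi₀ : i₀ ∈ A) (hj₀ : j₀ ∈ B) {v : V} {p : α → α → V}
    (hv : v ∈ W ⊓ swapInv ρ A ⊓ swapInv ρ B)
    (hp : ∀ i ∈ A.erase i₀, ∀ j ∈ B.erase j₀, p i j ∈ W ⊓ swapInv ρ A ⊓ swapInv ρ B)
    (hsum : v + ∑ i ∈ A.erase i₀, ∑ j ∈ B.erase j₀, ρ (swap i j) (p i j) = 0) :
    ∀ i ∈ A.erase i₀, ∀ j ∈ B.erase j₀, p i j = 0 := by
  have hne : ∀ p ∈ A, ∀ q ∈ B, p ≠ q := fun p hp q hq h => disjoint_left.1 hAB hp (h ▸ hq)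
  intro i hi j hj
  have hi' := mem_erase.1 hi
  have hj' := mem_erase.1 hj
  have h1 := congrArg (fun v => swapDiff ρ j j₀ (swapDiff ρ i i₀ v)) hsum
  simp only [map_add, map_sum, map_zero] at h1
  rw [swapDiff_eq_zero ρ hv.1.2 hi'.2 hi₀, map_zero, zero_add, sum_eq_single i, sum_eq_single j]
    at h1
  · have e1 := swapDiff_rho ρ (swap i j) j i₀ (p i j)
    rw [swap_apply_right, swap_apply_of_ne_of_ne hi'.1.symm (hne _ hi₀ _ hj'.2)] at e1
    have e2 := swapDiff_rho ρ (swap i j) i j₀ (swapDiff ρ j i₀ (p i j))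
    rw [swap_apply_left, swap_apply_of_ne_of_ne (hne _ hi'.2 _ hj₀).symm hj'.1.symm] at e2
    rw [e1, e2] at h1
    have h2 := congrArg (ρ (swap i j)) h1
    rw [rho_swap_swap, map_zero, show swapDiff ρ j i₀ (p i j) = swapDiff ρ i₀ j (p i j) by
      rw [swapDiff_apply, swapDiff_apply, swap_comm]] at h2
    exact eq_zero_of_swapDiff hAB hW hn h0 hi₀ hi'.2 hi'.1 hj'.2 hj₀ hj'.1.symm (hp i hi j hj) h2
  · intro j' hj'' hjj
    have hj3 := mem_erase.1 hj''
    rw [swapDiff_comm ρ (hne _ hi'.2 _ hj'.2).symm (hne _ hi₀ _ hj'.2).symm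
      (hne _ hi'.2 _ hj₀).symm (hne _ hi₀ _ hj₀).symm, swapDiff_rho_swap_eq_zero ρ
      (hp i hi j' hj'').2 hj'.2 hj₀ (hne _ hi'.2 _ hj'.2).symm hjj.symm
      (hne _ hi'.2 _ hj₀).symm hj3.1.symm, map_zero]
  · intro h; exact absurd hj h
  · intro i' hi'' hii
    have hi3 := mem_erase.1 hi''
    refine sum_eq_zero fun j' hj'' => ?_
    have hj3 := mem_erase.1 hj''
    rw [swapDiff_rho_swap_eq_zero ρ (hp i' hi'' j' hj'').1.2 hi'.2 hi₀ hii.symm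
      (hne _ hi'.2 _ hj3.2) hi3.1.symm (hne _ hi₀ _ hj3.2), map_zero]
  · intro h; exact absurd hi h

/-- The space of invariants and its translates by (i j), for i ≠ i₀ and j ≠ j₀, are independent
inside W. -/
theorem card_mul_finrank_le [FiniteDimensional K V] {A B : Finset α} (hAB : Disjoint A B)
    {W : Submodule K V}
    (hW : SwapStable ρ (A ∪ B) W) (hn : ((A ∪ B).card : K) ≠ 0)
    (h0 : ∀ x ∈ A ∪ B, ∀ u ∈ W, u ∈ swapInv ρ ((A ∪ B).erase x) → u = 0)
    (hA : A.Nonempty) (hB : B.Nonempty) :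
    (1 + (A.card - 1) * (B.card - 1))
      * finrank K (W ⊓ swapInv ρ A ⊓ swapInv ρ B : Submodule K V) ≤ finrank K W := by
  obtain ⟨i₀, hi₀⟩ := hA
  obtain ⟨j₀, hj₀⟩ := hB
  set T : Submodule K V := W ⊓ swapInv ρ A ⊓ swapInv ρ B with hT
  let Φ : (T × (A.erase i₀ → B.erase j₀ → T)) →ₗ[K] V :=
    T.subtype.comp (LinearMap.fst K _ _) +
      ∑ i : A.erase i₀, ∑ j : B.erase j₀, (ρ (swap i j)).comp
        (T.subtype.comp ((LinearMap.proj (φ := fun _ : B.erase j₀ => T) j).comp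
          ((LinearMap.proj (φ := fun _ : A.erase i₀ => B.erase j₀ → T) i).comp
            (LinearMap.snd K _ _))))
  have hΦ : ∀ p, Φ p = (p.1 : V) + ∑ i : A.erase i₀, ∑ j : B.erase j₀,
      ρ (swap i j) (p.2 i j : V) := by
    intro p
    simp [Φ]
  have hmem : ∀ p, Φ p ∈ W := by
    intro p
    rw [hΦ]
    exact W.add_mem p.1.2.1.1 (W.sum_mem fun i _ => W.sum_mem fun j _ =>
      hW i (mem_union_left _ (mem_of_mem_erase i.2)) j (mem_union_right _ (mem_of_mem_erase j.2))
        _ (p.2 i j).2.1.1)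
  have hinj : Function.Injective (Φ.codRestrict W hmem) := by
    rw [← LinearMap.ker_eq_bot, LinearMap.ker_codRestrict, LinearMap.ker_eq_bot']
    rintro ⟨q, u⟩ hp
    rw [hΦ] at hp
    simp only at hp
    let u' : α → α → V := fun i j =>
      if h : i ∈ A.erase i₀ ∧ j ∈ B.erase j₀ then (u ⟨i, h.1⟩ ⟨j, h.2⟩ : V) else 0
    have hu' : ∀ (i : A.erase i₀) (j : B.erase j₀), u' i j = u i j := fun i j => by
      simp only [u', i.2, j.2, and_self, dif_pos]
    have h1 : ∑ i : A.erase i₀, ∑ j : B.erase j₀, ρ (swap i j) (u i j : V)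
        = ∑ i ∈ A.erase i₀, ∑ j ∈ B.erase j₀, ρ (swap i j) (u' i j) := by
      rw [← sum_coe_sort (A.erase i₀)]
      refine sum_congr rfl fun i _ => ?_
      rw [← sum_coe_sort (B.erase j₀)]
      exact sum_congr rfl fun j _ => by rw [hu']
    rw [h1] at hp
    have h2 := eq_zero_of_sum_rho_swap hAB hW hn h0 hi₀ hj₀ q.2 (p := u')
      (fun i hi j hj => by rw [hu' ⟨i, hi⟩ ⟨j, hj⟩]; exact (u ⟨i, hi⟩ ⟨j, hj⟩).2) hp
    refine Prod.ext (Subtype.ext ?_) (funext fun i => funext fun j => Subtype.ext ?_)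
    · rw [sum_eq_zero fun i hi => sum_eq_zero fun j hj => by rw [h2 i hi j hj, map_zero],
        add_zero] at hp
      exact hp
    · rw [← hu', h2 i i.2 j j.2]
      rfl
  have h := LinearMap.finrank_le_finrank_of_injective hinj
  rw [finrank_prod, finrank_pi_fintype] at h
  simp only [finrank_pi_fintype, sum_const, card_univ, Fintype.card_coe, smul_eq_mul] at h
  rw [card_erase_of_mem hi₀, card_erase_of_mem hj₀] at h
  rw [add_mul, one_mul, mul_assoc]
  exact h

end Independence

/-! ### The dimension bound for two classes. -/

section TwoClasses

open Equiv Finset Module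

set_option linter.unusedSectionVars false

variable {K α V : Type*} [Field K] [Fintype α] [DecidableEq α] [AddCommGroup V] [Module K V]
  (ρ : Representation K (Perm α) V)

/-- For |A| = 2 the translates by transpositions give only the factor |B|. A further independent
translate, by the double transposition g exchanging A with two points of B, supplies the missing
one. -/
theorem card_add_one_mul_finrank_le [FiniteDimensional K V] {A B : Finset α}
    (hAB : Disjoint A B) {W : Submodule K V}
    (hW : SwapStable ρ (A ∪ B) W) (hn : ((A ∪ B).card : K) ≠ 0)
    (h0 : ∀ x ∈ A ∪ B, ∀ u ∈ W, u ∈ swapInv ρ ((A ∪ B).erase x) → u = 0)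
    (hA : A.card = 2) (hB : 3 ≤ B.card) :
    (B.card + 1)
      * finrank K (W ⊓ swapInv ρ A ⊓ swapInv ρ B : Submodule K V) ≤ finrank K W := by
  obtain ⟨i₀, i, hii, rfl⟩ := card_eq_two.1 hA
  obtain ⟨j₀, j₁, j₂, hj₀, hj₁, hj₂, h01, h02, h12⟩ := two_lt_card_iff.1 hB
  have hi₀ : i₀ ∈ ({i₀, i} : Finset α) := by simp
  have hi : i ∈ ({i₀, i} : Finset α) := by simp
  have hne : ∀ p ∈ ({i₀, i} : Finset α), ∀ q ∈ B, p ≠ q :=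
    fun p hp q hq h => disjoint_left.1 hAB hp (h ▸ hq)
  have hA1 : ({i₀, i} : Finset α).erase i₀ = {i} := by
    rw [erase_insert (by simpa using hii)]
  set A : Finset α := {i₀, i} with hAdef
  set T : Submodule K V := W ⊓ swapInv ρ A ⊓ swapInv ρ B with hT
  set g : Perm α := swap i₀ j₀ * swap i j₁ with hg
  have hgp : g ∈ permsOn (A ∪ B) := mul_mem_permsOn
    (swap_mem_permsOn (mem_union_left _ hi₀) (mem_union_right _ hj₀))
    (swap_mem_permsOn (mem_union_left _ hi) (mem_union_right _ hj₁))
  have g1 : g i₀ = j₀ := by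
    rw [hg, Perm.mul_apply, swap_apply_of_ne_of_ne hii (hne _ hi₀ _ hj₁), swap_apply_left]
  have g2 : g j₂ = j₂ := by
    rw [hg, Perm.mul_apply, swap_apply_of_ne_of_ne (hne _ hi _ hj₂).symm h12.symm,
      swap_apply_of_ne_of_ne (hne _ hi₀ _ hj₂).symm h02.symm]
  have g3 : g i = j₁ := by
    rw [hg, Perm.mul_apply, swap_apply_left,
      swap_apply_of_ne_of_ne (hne _ hi₀ _ hj₁).symm h01.symm]
  have g4 : g j₁ = i := by
    rw [hg, Perm.mul_apply, swap_apply_right, swap_apply_of_ne_of_ne hii.symm (hne _ hi _ hj₀)]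
  let Φ : (T × T × (B.erase j₀ → T)) →ₗ[K] V :=
    T.subtype.comp (LinearMap.fst K _ _) +
      ((ρ g).comp (T.subtype.comp ((LinearMap.fst K _ _).comp (LinearMap.snd K _ _))) +
      ∑ j : B.erase j₀, (ρ (swap i j)).comp
        (T.subtype.comp ((LinearMap.proj (φ := fun _ : B.erase j₀ => T) j).comp
          ((LinearMap.snd K _ _).comp (LinearMap.snd K _ _)))))
  have hΦ : ∀ p, Φ p = (p.1 : V) + (ρ g (p.2.1 : V) + ∑ j : B.erase j₀,
      ρ (swap i j) (p.2.2 j : V)) := by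
    intro p
    simp [Φ]
  have hmem : ∀ p, Φ p ∈ W := by
    intro p
    rw [hΦ]
    exact W.add_mem p.1.2.1.1 (W.add_mem (hW.apply_mem ρ hgp p.2.1.2.1.1) (W.sum_mem fun j _ =>
      hW i (mem_union_left _ hi) j (mem_union_right _ (mem_of_mem_erase j.2))
        _ (p.2.2 j).2.1.1))
  have hinj : Function.Injective (Φ.codRestrict W hmem) := by
    rw [← LinearMap.ker_eq_bot, LinearMap.ker_codRestrict, LinearMap.ker_eq_bot']
    rintro ⟨v, q, u⟩ hp
    rw [hΦ] at hp
    simp only at hp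
    have hq : (q : V) = 0 := by
      -- The third point j₂ of B makes this operator kill everything except the g-translate: (i j₂)
      -- carries invariance under (j₁ j₂) to invariance under (j₁ i), and all other terms are fixed
      -- by (j₀ j₂).
      have h1 := congrArg (fun v => swapDiff ρ j₀ j₂ (swapDiff ρ j₁ i v)) hp
      simp only [map_add, map_sum, map_zero] at h1
      have hcomm : ∀ w, swapDiff ρ j₀ j₂ (swapDiff ρ j₁ i w)
          = swapDiff ρ j₁ i (swapDiff ρ j₀ j₂ w) := fun w =>
        swapDiff_comm ρ h01 (hne _ hi _ hj₀).symm h12.symm (hne _ hi _ hj₂).symm w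
      have h2 : ∀ j : B.erase j₀,
          swapDiff ρ j₀ j₂ (swapDiff ρ j₁ i (ρ (swap i j) (u j : V))) = 0 := by
        intro j
        have hj := mem_erase.1 j.2
        by_cases hjj : (j : α) = j₂
        · have : swapDiff ρ j₁ i (ρ (swap i j) (u j : V)) = 0 := by
            apply swapDiff_rho_eq_zero ρ (u j).2.2
            · rwa [swap_inv, hjj, swap_apply_of_ne_of_ne (hne _ hi _ hj₁).symm h12]
            · rw [swap_inv, swap_apply_left]
              exact hj.2
          rw [this, map_zero]
        · rw [hcomm, swapDiff_rho_swap_eq_zero ρ (u j).2.2 hj₀ hj₂ (hne _ hi _ hj₀).symm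
            hj.1.symm (hne _ hi _ hj₂).symm (Ne.symm hjj), map_zero]
      rw [sum_eq_zero fun j _ => h2 j, add_zero, hcomm, swapDiff_eq_zero ρ v.2.2 hj₀ hj₂,
        map_zero, zero_add] at h1
      have e1 := swapDiff_rho ρ g i j₁ (q : V)
      have e2 := swapDiff_rho ρ g i₀ j₂ (swapDiff ρ i j₁ (q : V))
      rw [g3, g4] at e1
      rw [g1, g2] at e2
      rw [e1, e2] at h1
      have h3 := congrArg (ρ g⁻¹) h1
      have h4 := rho_inv_apply ρ g⁻¹ (swapDiff ρ i₀ j₂ (swapDiff ρ i j₁ (q : V)))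
      rw [inv_inv] at h4
      rw [h4, map_zero] at h3
      exact eq_zero_of_swapDiff hAB hW hn h0 hi hi₀ hii hj₁ hj₂ h12.symm q.2 h3
    rw [hq, map_zero, zero_add] at hp
    let u' : α → α → V := fun _ j => if h : j ∈ B.erase j₀ then (u ⟨j, h⟩ : V) else 0
    have hu' : ∀ (j : B.erase j₀), u' i j = u j := fun j => by
      simp only [u', j.2, dif_pos]
    have h1 : ∑ j : B.erase j₀, ρ (swap i j) (u j : V)
        = ∑ i ∈ A.erase i₀, ∑ j ∈ B.erase j₀, ρ (swap i j) (u' i j) := by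
      rw [hA1, sum_singleton, ← sum_coe_sort (B.erase j₀)]
      exact sum_congr rfl fun j _ => by rw [hu']
    rw [h1] at hp
    have h2 := eq_zero_of_sum_rho_swap hAB hW hn h0 hi₀ hj₀ v.2 (p := u')
      (fun i' hi' j hj => by
        rw [hA1, mem_singleton] at hi'
        rw [hi', hu' ⟨j, hj⟩]; exact (u ⟨j, hj⟩).2) hp
    refine Prod.ext (Subtype.ext ?_) (Prod.ext (Subtype.ext hq) (funext fun j => Subtype.ext ?_))
    · rw [sum_eq_zero fun i hi => sum_eq_zero fun j hj => by rw [h2 i hi j hj, map_zero],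
        add_zero] at hp
      exact hp
    · rw [← hu', h2 i (by simp [hA1]) j j.2]
      rfl
  have h := LinearMap.finrank_le_finrank_of_injective hinj
  rw [finrank_prod, finrank_prod, finrank_pi_fintype, sum_const, card_univ, Fintype.card_coe,
    smul_eq_mul, card_erase_of_mem hj₀] at h
  obtain ⟨b, hb⟩ : ∃ b, B.card = b + 1 := ⟨B.card - 1, by omega⟩
  rw [hb] at h ⊢
  simp only [Nat.add_sub_cancel] at h
  calc _ = _ := by ring
    _ ≤ _ := h

/-- The two-class bound for subspaces without invariants of point stabilizers. -/
theorem finrank_two_classes_of_nonstd [FiniteDimensional K V] {A B : Finset α}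
    (hAB : Disjoint A B) {W : Submodule K V}
    (hW : SwapStable ρ (A ∪ B) W) (hn : ((A ∪ B).card : K) ≠ 0)
    (h0 : ∀ x ∈ A ∪ B, ∀ u ∈ W, u ∈ swapInv ρ ((A ∪ B).erase x) → u = 0)
    (hA : A.Nonempty) (hB : B.Nonempty) (h22 : ¬(A.card = 2 ∧ B.card = 2)) :
    (A.card + B.card - 1)
      * finrank K (W ⊓ swapInv ρ A ⊓ swapInv ρ B : Submodule K V) ≤ finrank K W := by
  wlog hle : A.card ≤ B.card generalizing A B
  · have h := this hAB.symm (by rwa [union_comm]) (by rwa [union_comm]) (by rwa [union_comm])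
      hB hA (fun h => h22 ⟨h.2, h.1⟩) (by omega)
    rwa [add_comm, inf_right_comm] at h
  have hA0 := card_pos.2 hA
  rcases Nat.lt_or_ge A.card 2 with h1 | h2
  · obtain ⟨x, rfl⟩ := card_eq_one.1 (show A.card = 1 by omega)
    have hx : x ∉ B := disjoint_singleton_left.1 hAB
    have hbot : W ⊓ swapInv ρ {x} ⊓ swapInv ρ B = ⊥ := by
      rw [eq_bot_iff]
      rintro u ⟨⟨huW, -⟩, hu⟩
      refine h0 x (by simp) u huW ?_
      rwa [← insert_eq, erase_insert hx]
    rw [hbot, finrank_bot, mul_zero]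
    exact Nat.zero_le _
  rcases Nat.lt_or_ge A.card 3 with h3 | h3
  · have hA2 : A.card = 2 := by omega
    have hB3 : 3 ≤ B.card := by
      by_contra h
      exact h22 ⟨hA2, by omega⟩
    refine le_trans (Nat.mul_le_mul_right _ ?_)
      (card_add_one_mul_finrank_le ρ hAB hW hn h0 hA2 hB3)
    omega
  -- The inequality 1 + (a - 1)(b - 1) ≥ a + b - 1 amounts to (a - 2)(b - 2) ≥ 1, which is why size
  -- 2 is treated apart.
  · refine le_trans (Nat.mul_le_mul_right _ ?_) (card_mul_finrank_le ρ hAB hW hn h0 hA hB)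
    obtain ⟨a, ha⟩ : ∃ a, A.card = a + 3 := ⟨A.card - 3, by omega⟩
    obtain ⟨b, hb⟩ : ∃ b, B.card = b + 3 := ⟨B.card - 3, by omega⟩
    rw [ha, hb]
    have : a + 3 + (b + 3) - 1 = a + b + 5 := by omega
    rw [this]
    simp only [show a + 3 - 1 = a + 2 by omega,
      show b + 3 - 1 = b + 2 by omega]
    nlinarith

variable (hK : ((Fintype.card α).factorial : K) ≠ 0)
include hK

theorem nonstdPart_point_invariants {S : Finset α} {W : Submodule K V} :
    ∀ x ∈ S, ∀ u ∈ nonstdPart ρ S W, u ∈ swapInv ρ (S.erase x) → u = 0 :=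
  fun _ hx _ hu h => nonstdPart_inf_swapInv_erase ρ hK hx hu h

theorem card_cast_ne_zero {S : Finset α} (hS : S.Nonempty) : (S.card : K) ≠ 0 :=
  natCast_ne_zero_of_le_card hK (card_pos.2 hS).ne' (card_le_univ S)

/-- The standard and nonstandard parts satisfy the bound separately, and the two estimates add up.
-/
theorem finrank_two_classes_of_no_invariants [FiniteDimensional K V] {A B : Finset α}
    (hAB : Disjoint A B) {W : Submodule K V}
    (hW : SwapStable ρ (A ∪ B) W) (h0 : W ⊓ swapInv ρ (A ∪ B) = ⊥)
    (hA : A.Nonempty) (hB : B.Nonempty) (h22 : ¬(A.card = 2 ∧ B.card = 2)) :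
    (A.card + B.card - 1)
      * finrank K (W ⊓ swapInv ρ A ⊓ swapInv ρ B : Submodule K V) ≤ finrank K W := by
  obtain ⟨x, hx⟩ := hA
  have h1 := finrank_nonstdPart_add_le ρ hK hW h0 (mem_union_left _ hx)
  have h2 := finrank_inf_swapInv_le ρ hK hW h0 hAB rfl hx hB
  have h3 := finrank_two_classes_of_nonstd ρ hAB (swapStable_nonstdPart ρ hW)
    (card_cast_ne_zero hK ⟨x, mem_union_left _ hx⟩) (nonstdPart_point_invariants ρ hK) ⟨x, hx⟩
    hB h22
  rw [card_union_of_disjoint hAB] at h1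
  have h4 := Nat.mul_le_mul_left (A.card + B.card - 1) h2
  rw [mul_add] at h4
  omega

/-- The sum of the bounds for class sizes `(3, 1)` and `(2, 2)` in degree four. -/
theorem finrank_two_classes_four [FiniteDimensional K V] {A B C D S : Finset α}
    (hAB : Disjoint A B) (hCD : Disjoint C D) (hS : A ∪ B = S) (hS' : C ∪ D = S)
    {W : Submodule K V}
    (hW : SwapStable ρ S W) (h0 : W ⊓ swapInv ρ S = ⊥)
    (hA : A.card = 3) (hB : B.card = 1) (hC : C.card = 2) (hD : D.card = 2) :
    3 * (finrank K (W ⊓ swapInv ρ A ⊓ swapInv ρ B : Submodule K V)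
      + finrank K (W ⊓ swapInv ρ C ⊓ swapInv ρ D : Submodule K V)) ≤ 2 * finrank K W := by
  have hA' : A.Nonempty := card_pos.1 (by omega)
  have hB' : B.Nonempty := card_pos.1 (by omega)
  have hC' : C.Nonempty := card_pos.1 (by omega)
  have hD' : D.Nonempty := card_pos.1 (by omega)
  obtain ⟨x, hx⟩ := hC'
  have hxS : x ∈ S := hS' ▸ mem_union_left _ hx
  have hS4 : S.card = 4 := by rw [← hS, card_union_of_disjoint hAB]; omega
  have h1 := finrank_nonstdPart_add_le ρ hK hW h0 hxS
  have h2 := finrank_inf_swapInv_le ρ hK hW h0 hCD hS' hx hD'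
  have hW2 := swapStable_nonstdPart ρ hW
  have hp := nonstdPart_point_invariants ρ hK (S := S) (W := W)
  have hn : (S.card : K) ≠ 0 := card_cast_ne_zero hK ⟨x, hxS⟩
  have h3 : 2 * finrank K (nonstdPart ρ S W ⊓ swapInv ρ C ⊓ swapInv ρ D : Submodule K V)
      ≤ finrank K (nonstdPart ρ S W) := by
    have := card_mul_finrank_le ρ hCD (W := nonstdPart ρ S W) (by rwa [hS'])
      (by rwa [hS']) (by rwa [hS']) ⟨x, hx⟩ hD'
    rwa [hC, hD] at this
  have h4 := finrank_two_classes_of_no_invariants ρ hK hAB (W := W) (by rwa [hS]) (by rwa [hS])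
    hA' hB' (by omega)
  rw [hS4] at h1
  rw [hA, hB] at h4
  have h5 : finrank K (W ⊓ swapInv ρ A ⊓ swapInv ρ B : Submodule K V)
      ≤ finrank K (W ⊓ swapInv ρ (S.erase x) : Submodule K V) := by
    obtain ⟨y, rfl⟩ := card_eq_one.1 hB
    have hy : y ∉ A := disjoint_singleton_right.1 hAB
    have hAS : S.erase y = A := by
      rw [← hS, union_comm, ← insert_eq, erase_insert hy]
    have hyS : y ∈ S := by rw [← hS]; simp
    refine LinearMap.finrank_le_finrank_of_injective
      (f := ((ρ (swap y x)).comp (W ⊓ swapInv ρ A ⊓ swapInv ρ {y}).subtype).codRestrict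
        (W ⊓ swapInv ρ (S.erase x)) ?_) ?_
    · rintro ⟨u, ⟨huW, huA⟩, -⟩
      refine ⟨hW y hyS x hxS u huW, ?_⟩
      rw [← hAS] at huA
      exact rho_swap_mem_swapInv_erase ρ hyS hxS huA
    · intro u v huv
      have h := congrArg (fun w => ρ (swap y x) (Subtype.val w)) huv
      simp only [LinearMap.codRestrict_apply, LinearMap.comp_apply, rho_swap_swap] at h
      exact Subtype.ext h
  -- With t the dimension of the point-stabilizer invariants and q that of the nonstandard part, the
  -- two terms are at most t and t + q/2, while q + 3t ≤ dim W.
  omega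

/-- For a stable subspace `W`, the invariants of `S_A × S_B` in `W` are few. -/
theorem finrank_two_classes [FiniteDimensional K V] {A B : Finset α}
    (hAB : Disjoint A B) {W : Submodule K V}
    (hW : SwapStable ρ (A ∪ B) W)
    (hA : A.Nonempty) (hB : B.Nonempty) (h22 : ¬(A.card = 2 ∧ B.card = 2)) :
    (A.card + B.card - 1) * finrank K (W ⊓ swapInv ρ A ⊓ swapInv ρ B : Submodule K V)
        + finrank K (W ⊓ swapInv ρ (A ∪ B) : Submodule K V)
      ≤ (A.card + B.card - 1) * finrank K (W ⊓ swapInv ρ (A ∪ B) : Submodule K V)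
        + finrank K W := by
  set S := A ∪ B with hS
  -- The kernel of the full average is the stable complement of the S-invariants in W.
  set W' : Submodule K V := W ⊓ LinearMap.ker (swapAvg ρ S) with hW'def
  have hW' : SwapStable ρ S W' := by
    intro x hx y hy w hw
    refine ⟨hW x hx y hy w hw.1, ?_⟩
    change swapAvg ρ S _ = 0
    rw [swapAvg_swap ρ hx hy]
    exact hw.2
  have h0 : W' ⊓ swapInv ρ S = ⊥ := by
    rw [eq_bot_iff]
    rintro u ⟨⟨-, hu⟩, hu'⟩
    rw [Submodule.mem_bot, ← swapAvg_eq_self ρ hK hu']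
    exact hu
  have h1 := finrank_two_classes_of_no_invariants ρ hK hAB hW' h0 hA hB h22
  have h2 : finrank K (W ⊓ swapInv ρ A ⊓ swapInv ρ B : Submodule K V)
      ≤ finrank K (W ⊓ swapInv ρ S : Submodule K V)
        + finrank K (W' ⊓ swapInv ρ A ⊓ swapInv ρ B : Submodule K V) := by
    refine finrank_le_add_of_map_le (swapAvg ρ S) ?_ ?_
    · exact fun w hw => ⟨hW.swapAvg_mem ρ subset_rfl hw.1.1, swapAvg_mem_swapInv ρ _ w⟩
    · exact fun w hw h => ⟨⟨⟨hw.1.1, h⟩, hw.1.2⟩, hw.2⟩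
  have h3 : finrank K (W ⊓ swapInv ρ S : Submodule K V) + finrank K W' ≤ finrank K W := by
    have h := Submodule.finrank_sup_add_finrank_inf_eq (W ⊓ swapInv ρ S) W'
    have hbot : W ⊓ swapInv ρ S ⊓ W' = ⊥ := by
      rw [eq_bot_iff, ← h0]
      exact fun u hu => ⟨hu.2, hu.1.2⟩
    rw [hbot, finrank_bot, add_zero] at h
    rw [← h]
    exact Submodule.finrank_mono (sup_le inf_le_left inf_le_left)
  have h4 := Nat.mul_le_mul_left (A.card + B.card - 1) h2
  rw [mul_add] at h4
  omega

end TwoClasses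

/-! ### Invariants of Young subgroups with any number of classes. -/

section ColorClasses

open Equiv Finset Module

set_option linter.unusedSectionVars false

variable {K α V ι : Type*} [Field K] [Fintype α] [DecidableEq α] [AddCommGroup V] [Module K V]
  [DecidableEq ι] (ρ : Representation K (Perm α) V)

/-- The points of C are added to B one at a time, each by the two-class bound with a singleton
class. The resulting inequality carries a common factor |B| - 1 + |C|, so the case where this
vanishes is separate. -/
theorem finrank_one_class [FiniteDimensional K V] (hK : ((Fintype.card α).factorial : K) ≠ 0)
    {B C : Finset α} (hBC : Disjoint B C) (hB : B.Nonempty) {W : Submodule K V}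
    (hW : SwapStable ρ (B ∪ C) W) :
    (B.card - 1 + C.card) * finrank K (W ⊓ swapInv ρ B : Submodule K V)
      ≤ (B.card - 1) * finrank K (W ⊓ swapInv ρ (B ∪ C) : Submodule K V)
        + C.card * finrank K W := by
  induction C using Finset.induction_on with
  | empty =>
    rw [union_empty]
    simp
  | insert y C hy ih =>
    rw [disjoint_insert_right] at hBC
    have hu : B ∪ insert y C = {y} ∪ (B ∪ C) := by
      ext z; simp only [mem_union, mem_insert, mem_singleton]; tauto
    have hd : Disjoint {y} (B ∪ C) := by
      rw [disjoint_singleton_left, mem_union]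
      exact fun h => h.elim hBC.1 hy
    rw [hu] at hW ⊢
    have h1 := ih hBC.2 (hW.mono ρ subset_union_right)
    have hB0 := card_pos.2 hB
    have hf : finrank K (W ⊓ swapInv ρ B : Submodule K V) ≤ finrank K W :=
      Submodule.finrank_mono inf_le_left
    obtain ⟨a, ha⟩ : ∃ a, B.card = a + 1 := ⟨B.card - 1, by omega⟩
    have hcard : (B ∪ C).card = a + 1 + C.card := by rw [card_union_of_disjoint hBC.2, ha]
    rw [card_insert_of_notMem hy]
    simp only [ha, Nat.add_sub_cancel] at h1 ⊢
    by_cases h0 : a + C.card = 0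
    · have : a = 0 := by omega
      have : C.card = 0 := by omega
      simp_all
    have h2 := finrank_two_classes ρ hK hd hW (singleton_nonempty y) (hB.mono subset_union_left)
      (by simp)
    have hWy : W ⊓ swapInv ρ {y} = W := by
      refine inf_eq_left.2 fun w _ p hp q hq => ?_
      rw [mem_singleton.1 hp, mem_singleton.1 hq, rho_swap_self]
    rw [hWy, hcard, card_singleton] at h2
    set c := C.card
    rw [show 1 + (a + 1 + c) - 1 = a + c + 1 by omega] at h2
    refine le_of_mul_le_mul_left (?_ : (a + c) * _ ≤ (a + c) * _) (Nat.pos_of_ne_zero h0)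
    nlinarith [Nat.mul_le_mul_left (a + c + 1) h1, Nat.mul_le_mul_left a h2]

/-- The vectors fixed by all transpositions of two elements of `S` of the same colour. -/
def colorInv (S : Finset α) (c : α → ι) : Submodule K V where
  carrier := {w | ∀ x ∈ S, ∀ y ∈ S, c x = c y → ρ (swap x y) w = w}
  zero_mem' := by simp
  add_mem' := by
    intro a b ha hb x hx y hy hxy
    rw [map_add, ha x hx y hy hxy, hb x hx y hy hxy]
  smul_mem' := by
    intro k a ha x hx y hy hxy
    rw [map_smul, ha x hx y hy hxy]

theorem inf_colorInv_eq (S : Finset α) (c : α → ι) (v : ι) (W : Submodule K V) :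
    W ⊓ colorInv ρ S c
      = W ⊓ swapInv ρ (S.filter (c · = v)) ⊓ colorInv ρ (S.filter (c · ≠ v)) c := by
  ext w
  constructor
  · rintro ⟨hW, h⟩
    refine ⟨⟨hW, fun x hx y hy => ?_⟩, fun x hx y hy => ?_⟩
    · rw [mem_filter] at hx hy
      exact h x hx.1 y hy.1 (hx.2.trans hy.2.symm)
    · exact h x (mem_filter.1 hx).1 y (mem_filter.1 hy).1
  · rintro ⟨⟨hW, h1⟩, h2⟩
    refine ⟨hW, fun x hx y hy hxy => ?_⟩
    by_cases hv : c x = v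
    · exact h1 x (mem_filter.2 ⟨hx, hv⟩) y (mem_filter.2 ⟨hy, hxy ▸ hv⟩)
    · exact h2 x (mem_filter.2 ⟨hx, hv⟩) y (mem_filter.2 ⟨hy, hxy ▸ hv⟩) hxy

theorem colorInv_of_card_image_eq_one {S : Finset α} {c : α → ι} (h : (S.image c).card = 1) :
    colorInv ρ S c = swapInv ρ S := by
  obtain ⟨v, hv⟩ := card_eq_one.1 h
  have hc : ∀ x ∈ S, c x = v := fun x hx => by
    have := mem_image_of_mem c hx
    rwa [hv, mem_singleton] at this
  ext w
  exact ⟨fun hw x hx y hy => hw x hx y hy ((hc x hx).trans (hc y hy).symm),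
    fun hw x hx y hy _ => hw x hx y hy⟩

theorem image_filter_ne (S : Finset α) (c : α → ι) (v : ι) :
    (S.filter (c · ≠ v)).image c = (S.image c).erase v := by
  ext u
  simp only [mem_image, mem_filter, mem_erase]
  constructor
  · rintro ⟨x, ⟨hx, hxv⟩, rfl⟩
    exact ⟨hxv, x, hx, rfl⟩
  · rintro ⟨hu, x, hx, rfl⟩
    exact ⟨x, ⟨hx, hu⟩, rfl⟩

/-- The invariants in `W` of the Young subgroup of a colouring with `k + 1` colours have dimension
at most `k / (n - 1)` times `dim W`, up to the contribution of the full invariants. -/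
theorem finrank_color_classes [FiniteDimensional K V]
    (hK : ((Fintype.card α).factorial : K) ≠ 0) (c : α → ι) (k : ℕ) :
    ∀ (S : Finset α) (W : Submodule K V), SwapStable ρ S W → (S.image c).card = k + 1 →
      (∃ v ∈ S.image c, (S.filter (c · = v)).card ≠ 2) →
      (S.card - 1) * finrank K (W ⊓ colorInv ρ S c : Submodule K V)
          + k * finrank K (W ⊓ swapInv ρ S : Submodule K V)
        ≤ (S.card - 1) * finrank K (W ⊓ swapInv ρ S : Submodule K V) + k * finrank K W := by
  induction k with
  | zero =>
    intro S W _ h1 _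
    rw [colorInv_of_card_image_eq_one ρ h1]
    simp
  | succ k ih =>
    intro S W hW hk ⟨v₀, hv₀, h2⟩
    have hcls : ∀ u ∈ S.image c, (S.filter (c · = u)).Nonempty := by
      intro u hu
      obtain ⟨x, hx, rfl⟩ := mem_image.1 hu
      exact ⟨x, mem_filter.2 ⟨hx, rfl⟩⟩
    -- The class split off is a smallest one other than that of v₀: the class of v₀, of size ≠ 2,
    -- survives in the rest, and minimality rules out |B| = |S'| = 2 below.
    obtain ⟨v, hv, hmin⟩ := exists_min_image ((S.image c).erase v₀)
      (fun u => (S.filter (c · = u)).card) (by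
        apply card_pos.1
        rw [card_erase_of_mem hv₀]
        omega)
    rw [mem_erase] at hv
    set B := S.filter (c · = v) with hB
    set S' := S.filter (c · ≠ v) with hS'
    have hU : B ∪ S' = S := filter_union_filter_not_eq _ _
    have hd : Disjoint B S' := disjoint_filter_filter_not _ _ _
    have himg : S'.image c = (S.image c).erase v := image_filter_ne S c v
    have hk' : (S'.image c).card = k + 1 := by
      rw [himg, card_erase_of_mem hv.2, hk]
      rfl
    have hsub : ∀ u, u ≠ v → S'.filter (c · = u) = S.filter (c · = u) := by
      intro u hu
      rw [hS', filter_filter]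
      exact filter_congr fun x _ => ⟨fun h => h.2, fun h => ⟨h ▸ hu, h⟩⟩
    have hv₀' : v₀ ∈ S'.image c := by rw [himg]; exact mem_erase.2 ⟨hv.1.symm, hv₀⟩
    have hBne : B.Nonempty := hcls v hv.2
    have hS'ne : S'.Nonempty := by
      obtain ⟨x, hx, -⟩ := mem_image.1 hv₀'
      exact ⟨x, hx⟩
    have h2' : (S'.filter (c · = v₀)).card ≠ 2 := by rwa [hsub v₀ hv.1.symm]
    have h22 : ¬(B.card = 2 ∧ S'.card = 2) := by
      rintro ⟨hb, hs⟩
      rcases Nat.eq_zero_or_pos k with rfl | hkpos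
      · obtain ⟨u, hu⟩ := card_eq_one.1 hk'
        rw [hu, mem_singleton] at hv₀'
        apply h2'
        rw [filter_true_of_mem, hs]
        intro x hx
        have := mem_image_of_mem c hx
        rw [hu, mem_singleton] at this
        rw [this, hv₀']
      · obtain ⟨u, hu, huv⟩ := exists_mem_ne (show 1 < (S'.image c).card by omega) v₀
        have huS : u ≠ v ∧ u ∈ S.image c := by rw [himg, mem_erase] at hu; exact hu
        have h3 := hmin u (mem_erase.2 ⟨huv, huS.2⟩)
        have h4 : (S'.filter (c · = v₀)).card + (S'.filter (c · = u)).card ≤ S'.card := by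
          rw [← card_union_of_disjoint]
          · exact card_le_card (union_subset (filter_subset _ _) (filter_subset _ _))
          · rw [disjoint_left]
            intro x hx hx'
            exact huv ((mem_filter.1 hx').2.symm.trans (mem_filter.1 hx).2)
        rw [hsub u huS.1, hsub v₀ hv.1.symm] at h4
        have h5 := card_pos.2 (hcls v₀ hv₀)
        omega
    have hWU : SwapStable ρ (B ∪ S') W := by rwa [hU]
    have hT := finrank_two_classes ρ hK hd hWU hBne hS'ne h22
    rw [hU] at hT
    have hW' : SwapStable ρ S' (W ⊓ swapInv ρ B) := by
      intro x hx y hy w hw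
      refine ⟨hW x (mem_filter.1 hx).1 y (mem_filter.1 hy).1 w hw.1, fun p hp q hq => ?_⟩
      have hne : ∀ p ∈ B, ∀ x ∈ S', p ≠ x := fun p hp x hx h => disjoint_left.1 hd hp (h ▸ hx)
      rw [rho_swap_comm_of_ne ρ (hne p hp x hx) (hne p hp y hy) (hne q hq x hx) (hne q hq y hy),
        hw.2 p hp q hq]
    have hI := ih S' (W ⊓ swapInv ρ B) hW' hk' ⟨v₀, hv₀', h2'⟩
    have hone := finrank_one_class ρ hK hd hBne hWU
    rw [hU] at hone
    have hcol : W ⊓ colorInv ρ S c = W ⊓ swapInv ρ B ⊓ colorInv ρ S' c :=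
      inf_colorInv_eq ρ S c v W
    rw [hcol]
    have hSc : S.card = B.card + S'.card := by rw [← hU, card_union_of_disjoint hd]
    have hB0 := card_pos.2 hBne
    have hS0 : k + 1 ≤ S'.card := hk' ▸ card_image_le
    obtain ⟨a, ha⟩ : ∃ a, B.card = a + 1 := ⟨B.card - 1, by omega⟩
    obtain ⟨l, hl⟩ : ∃ l, S'.card = k + l + 1 := ⟨S'.card - 1 - k, by omega⟩
    rw [hSc]
    rw [ha, hl] at hT hone ⊢
    rw [hl] at hI
    rcases Nat.eq_zero_or_pos k with rfl | hkpos
    · rw [colorInv_of_card_image_eq_one ρ hk']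
      omega
    simp only [Nat.add_sub_cancel, show a + 1 + (k + l + 1) - 1 = a + k + l + 1 by omega,
      show a + (k + l + 1) = a + k + l + 1 by omega] at hI hT hone ⊢
    -- Induction is applied to the B-invariants of W. The bounds for the classes B, S' and for B
    -- alone enter with weights l and k, and l + k(k + l + 1) = (k + l)(k + 1) gives the coefficient
    -- of dim W.
    refine le_of_mul_le_mul_left (?_ : (k + l) * _ ≤ (k + l) * _) (by omega)
    nlinarith [Nat.mul_le_mul_left (a + k + l + 1) hI, Nat.mul_le_mul_left l hT,
      Nat.mul_le_mul_left k hone]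

end ColorClasses

/-! ### A criterion for being generated by r elements. -/

section GeneratedModules

open Finset Module

theorem isRGenerated_submodule_iff {A V : Type*} [Ring A] [AddCommGroup V] [Module A V]
    {N : Submodule A V} {r : ℕ} :
    IsRGenerated A N r ↔ ∃ f : Fin r → V, Submodule.span A (Set.range f) = N := by
  constructor
  · rintro ⟨f, hf⟩
    refine ⟨fun i => f i, ?_⟩
    have h := congrArg (Submodule.map N.subtype) hf
    rw [Submodule.map_span, Submodule.map_top, Submodule.range_subtype, ← Set.range_comp] at h
    exact h
  · rintro ⟨f, hf⟩
    have hmem : ∀ i, f i ∈ N := fun i => hf ▸ Submodule.subset_span ⟨i, rfl⟩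
    refine ⟨fun i => ⟨f i, hmem i⟩, ?_⟩
    apply Submodule.map_injective_of_injective N.injective_subtype
    rw [Submodule.map_span, Submodule.map_top, Submodule.range_subtype, ← Set.range_comp]
    exact hf

theorem isRGenerated_range {A V : Type*} [Ring A] [AddCommGroup V] [Module A V] {r : ℕ}
    (h : (Fin r → A) →ₗ[A] V) : IsRGenerated A (LinearMap.range h) r := by
  rw [isRGenerated_submodule_iff]
  refine ⟨fun i => h (Pi.single i 1), ?_⟩
  rw [← Fintype.range_linearCombination A]
  congr 1
  refine LinearMap.pi_ext' fun i => LinearMap.ext_ring ?_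
  simp [Fintype.linearCombination_apply_single]

variable {K A V : Type*} [Field K] [Ring A] [Algebra K A] [AddCommGroup V] [Module K V]
  [Module A V] [IsScalarTower K A V]

instance finiteDimensional_hom {W : Type*} [AddCommGroup W] [Module K W] [Module A W]
    [IsScalarTower K A W] [FiniteDimensional K V] [FiniteDimensional K W] :
    FiniteDimensional K (V →ₗ[A] W) :=
  FiniteDimensional.of_injective (LinearMap.restrictScalarsₗ K A V W K)
    (LinearMap.restrictScalars_injective K)

/-- A finite-dimensional module over a semisimple algebra is `r`-generated if every simple
submodule `W` satisfies `dim Hom(V, W) ≤ r dim W`. -/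
theorem isRGenerated_of_finrank_hom_le [IsSemisimpleRing A] [FiniteDimensional K V] (r : ℕ)
    (h : ∀ W : Submodule A V, IsSimpleModule A W →
      finrank K (V →ₗ[A] W) ≤ r * finrank K W) : IsRGenerated A V r := by
  have hnoeth : IsNoetherian A V := isNoetherian_of_tower K inferInstance
  obtain ⟨N, hN, hmax⟩ := set_has_maximal_iff_noetherian.2 hnoeth
    {N : Submodule A V | IsRGenerated A N r}
    ⟨LinearMap.range (0 : (Fin r → A) →ₗ[A] V), isRGenerated_range _⟩
  obtain ⟨f, hf⟩ := isRGenerated_submodule_iff.1 hN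
  by_cases htop : N = ⊤
  · exact ⟨f, hf.trans htop⟩
  exfalso
  obtain ⟨C, hC⟩ := exists_isCompl N
  have hCne : Nontrivial C := by
    rw [Submodule.nontrivial_iff_ne_bot]
    rintro rfl
    exact htop (by simpa using hC.sup_eq_top)
  obtain ⟨W₀, hW₀⟩ := IsSemisimpleModule.exists_simple_submodule A C
  set W : Submodule A V := W₀.map C.subtype with hWdef
  have hWC : W ≤ C := by
    rw [hWdef]
    exact Submodule.map_subtype_le _ _
  have hW : IsSimpleModule A W :=
    IsSimpleModule.congr (W₀.equivMapOfInjective C.subtype C.injective_subtype).symm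
  set g : (Fin r → A) →ₗ[A] V := Fintype.linearCombination A f with hg
  have hgN : LinearMap.range g = N := by rw [hg, Fintype.range_linearCombination, hf]
  obtain ⟨L', hL'⟩ := exists_isCompl (LinearMap.ker g)
  -- If some ψ were nonzero on ker g, adding to g the composite of ψ with the projection to ker g
  -- would give an r-generated module containing N and a nonzero vector of W, against maximality.
  have hker : ∀ ψ : (Fin r → A) →ₗ[A] W, LinearMap.ker g ≤ LinearMap.ker ψ := by
    intro ψ
    by_contra hψ
    obtain ⟨l, hl, hlψ⟩ := SetLike.not_le_iff_exists.1 hψ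
    set k : (Fin r → A) →ₗ[A] V :=
      g + W.subtype.comp (ψ.comp ((LinearMap.ker g).subtype.comp
        ((LinearMap.ker g).projectionOnto L' hL'))) with hk
    have hk1 : ∀ z ∈ L', k z = g z := by
      intro z hz
      simp [hk, Submodule.projectionOnto_apply_of_mem_right hL' hz]
    have hk2 : k l = ψ l := by
      have h1 : (LinearMap.ker g).projectionOnto L' hL' l = ⟨l, hl⟩ :=
        Submodule.projectionOnto_apply_left hL' ⟨l, hl⟩
      have h2 : g l = 0 := hl
      simp [hk, h1, h2]
    have hNk : N ≤ LinearMap.range k := by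
      rw [← hgN]
      rintro _ ⟨z, rfl⟩
      have hz : z ∈ LinearMap.ker g ⊔ L' := by rw [hL'.sup_eq_top]; trivial
      obtain ⟨a, ha, b, hb, rfl⟩ := Submodule.mem_sup.1 hz
      refine ⟨b, ?_⟩
      rw [hk1 b hb, map_add, show g a = 0 from ha, zero_add]
    refine hmax _ (isRGenerated_range k) (lt_of_le_of_ne hNk ?_)
    intro heq
    have h1 : (ψ l : V) ∈ N := by
      rw [heq]
      exact ⟨l, hk2⟩
    have h2 : (ψ l : V) ∈ N ⊓ C := ⟨h1, hWC (ψ l).2⟩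
    rw [hC.inf_eq_bot, Submodule.mem_bot] at h2
    exact hlψ (Subtype.ext h2)
  let Θ : (V →ₗ[A] W) →ₗ[K] (Fin r → W) :=
    { toFun := fun φ i => φ (f i)
      map_add' := fun _ _ => rfl
      map_smul' := fun _ _ => rfl }
  -- By `hker` every map A^r → W factors through N, and it extends to V by zero on C. So values in W
  -- can be prescribed freely at the generators.
  have hsurj : Function.Surjective Θ := by
    intro w
    set ψ : (Fin r → A) →ₗ[A] W := Fintype.linearCombination A w with hψ
    let χ : LinearMap.range g →ₗ[A] W :=
      ((LinearMap.ker g).liftQ ψ (hker ψ)).comp g.quotKerEquivRange.symm.toLinearMap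
    rw [← hgN] at hC
    refine ⟨χ.comp ((LinearMap.range g).projectionOnto C hC), funext fun i => ?_⟩
    have h1 : f i = g (Pi.single i 1) := by
      rw [hg, Fintype.linearCombination_apply_single, one_smul]
    have h2 : (LinearMap.range g).projectionOnto C hC (f i)
        = ⟨g (Pi.single i 1), ⟨_, rfl⟩⟩ := by
      rw [h1]
      exact Submodule.projectionOnto_apply_left hC ⟨g (Pi.single i 1), ⟨_, rfl⟩⟩
    change χ ((LinearMap.range g).projectionOnto C hC (f i)) = w i
    rw [h2]
    change (LinearMap.ker g).liftQ ψ (hker ψ) (g.quotKerEquivRange.symm _) = _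
    have h3 : g.quotKerEquivRange.symm ⟨g (Pi.single i 1), ⟨_, rfl⟩⟩
        = (LinearMap.ker g).mkQ (Pi.single i 1) := g.quotKerEquivRange_symm_apply_image _ _
    rw [h3, Submodule.mkQ_apply, Submodule.liftQ_apply, hψ,
      Fintype.linearCombination_apply_single, one_smul]
  obtain ⟨D, hD⟩ := exists_isCompl W
  -- The projection of V onto W through C is a nonzero element of ker Θ, so dim Hom(V, W) exceeds r
  -- dim W.
  let φ : V →ₗ[A] W := (W.projectionOnto D hD).comp
    (C.subtype.comp (C.projectionOnto N hC.symm))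
  have hφ0 : Θ φ = 0 := by
    funext i
    have hfi : f i ∈ N := hf ▸ Submodule.subset_span ⟨i, rfl⟩
    change W.projectionOnto D hD (C.projectionOnto N hC.symm (f i) : V) = 0
    rw [Submodule.projectionOnto_apply_of_mem_right hC.symm hfi]
    simp
  have hφ : φ ≠ 0 := by
    intro h0
    have := IsSimpleModule.nontrivial A W
    obtain ⟨w, hw⟩ := exists_ne (0 : W)
    apply hw
    have h1 : φ w = w := by
      change W.projectionOnto D hD (C.projectionOnto N hC.symm (w : V) : V) = w
      have h2 : C.projectionOnto N hC.symm (w : V) = ⟨w, hWC w.2⟩ :=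
        Submodule.projectionOnto_apply_left hC.symm ⟨w, hWC w.2⟩
      rw [h2]
      exact Submodule.projectionOnto_apply_left hD w
    rw [← h1, h0, LinearMap.zero_apply]
  have hfin : FiniteDimensional K W :=
    inferInstanceAs (FiniteDimensional K (W.restrictScalars K))
  have hrank := LinearMap.finrank_range_add_finrank_ker Θ
  rw [LinearMap.range_eq_top.2 hsurj, finrank_top, finrank_pi_fintype, sum_const, card_univ,
    Fintype.card_fin, smul_eq_mul] at hrank
  have hpos : 0 < finrank K (LinearMap.ker Θ) := by
    rw [Nat.pos_iff_ne_zero, Ne, Submodule.finrank_eq_zero]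
    intro hb
    have : φ ∈ LinearMap.ker Θ := hφ0
    rw [hb, Submodule.mem_bot] at this
    exact hφ this
  have := h W hW
  omega

end GeneratedModules

/-! ### Maximal submodules and the splitting by a central idempotent. -/

section TrivialPart

open Finset Module

variable {K A V : Type*} [Field K] [Ring A] [Algebra K A] [AddCommGroup V] [Module K V]
  [Module A V] [IsScalarTower K A V]

variable (V) in
/-- Multiplication by a central element as a linear endomorphism. -/
def centralMul (e : A) (hc : ∀ a, a * e = e * a) : V →ₗ[A] V where
  toFun v := e • v
  map_add' := smul_add e
  map_smul' a v := by
    rw [RingHom.id_apply, smul_smul, smul_smul, hc]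

variable {e : A} {hc : ∀ a, a * e = e * a}

theorem centralMul_apply (v : V) : centralMul V e hc v = e • v := rfl

/-- Applying e to M gives its intersection with the range. As Ae lies in Ke, the vectors e f_i span
it already over K. -/
theorem finrank_inf_range_le [FiniteDimensional K V] (he : e * e = e)
    (hε : ∀ a, ∃ k : K, a * e = k • e) {r : ℕ}
    {M : Submodule A V} (hM : IsRGenerated A M r) :
    finrank K (M ⊓ LinearMap.range (centralMul V e hc) : Submodule A V) ≤ r := by
  obtain ⟨f, hf⟩ := isRGenerated_submodule_iff.1 hM
  have h1 : (M ⊓ LinearMap.range (centralMul V e hc)).restrictScalars K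
      ≤ Submodule.span K (Set.range fun i => e • f i) := by
    rintro _ ⟨hm, m, rfl⟩
    have h2 : ∀ x ∈ M, e • x ∈ Submodule.span K (Set.range fun i => e • f i) := by
      intro x hx
      rw [← hf] at hx
      induction hx using Submodule.span_induction with
      | mem x hx =>
        obtain ⟨i, rfl⟩ := hx
        exact Submodule.subset_span ⟨i, rfl⟩
      | zero => simp
      | add x y _ _ h1 h2 => rw [smul_add]; exact Submodule.add_mem _ h1 h2
      | smul a x _ h =>
        obtain ⟨k, hk⟩ := hε a
        rw [smul_smul, ← hc, hk, smul_assoc]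
        exact Submodule.smul_mem _ k h
    have h3 := h2 _ hm
    rwa [centralMul_apply, smul_smul, he] at h3
  calc finrank K ((M ⊓ LinearMap.range (centralMul V e hc)).restrictScalars K)
      ≤ finrank K (Submodule.span K (Set.range fun i => e • f i)) := Submodule.finrank_mono h1
    _ ≤ r := (finrank_range_le_card _).trans_eq (Fintype.card_fin r)

theorem isRGenerated_inf_ker (he : e * e = e) {r : ℕ}
    {M : Submodule A V} (hM : IsRGenerated A M r) :
    IsRGenerated A (M ⊓ LinearMap.ker (centralMul V e hc) : Submodule A V) r := by
  obtain ⟨f, hf⟩ := isRGenerated_submodule_iff.1 hM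
  rw [isRGenerated_submodule_iff]
  refine ⟨fun i => f i - e • f i, le_antisymm ?_ ?_⟩
  · rw [Submodule.span_le]
    rintro _ ⟨i, rfl⟩
    have hfi : f i ∈ M := hf ▸ Submodule.subset_span ⟨i, rfl⟩
    refine ⟨M.sub_mem hfi (M.smul_mem e hfi), ?_⟩
    change e • (f i - e • f i) = 0
    rw [smul_sub, smul_smul, he, sub_self]
  · rintro m ⟨hm, hm0⟩
    have h2 : ∀ x ∈ M, x - e • x ∈ Submodule.span A (Set.range fun i => f i - e • f i) := by
      intro x hx
      rw [← hf] at hx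
      induction hx using Submodule.span_induction with
      | mem x hx =>
        obtain ⟨i, rfl⟩ := hx
        exact Submodule.subset_span ⟨i, rfl⟩
      | zero => simp
      | add x y _ _ h1 h2 =>
        rw [smul_add, add_sub_add_comm]
        exact Submodule.add_mem _ h1 h2
      | smul a x _ h =>
        rw [smul_smul, ← hc, ← smul_smul, ← smul_sub]
        exact Submodule.smul_mem _ a h
    have h3 := h2 m hm
    rwa [show e • m = 0 from hm0, sub_zero] at h3

theorem finrank_eq_inf_range_add_inf_ker [FiniteDimensional K V] (he : e * e = e)
    (M : Submodule A V) :
    finrank K M = finrank K (M ⊓ LinearMap.range (centralMul V e hc) : Submodule A V)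
      + finrank K (M ⊓ LinearMap.ker (centralMul V e hc) : Submodule A V) := by
  have h := Submodule.finrank_sup_add_finrank_inf_eq
    ((M ⊓ LinearMap.range (centralMul V e hc)).restrictScalars K)
    ((M ⊓ LinearMap.ker (centralMul V e hc)).restrictScalars K)
  have h1 : (M ⊓ LinearMap.range (centralMul V e hc)).restrictScalars K
      ⊔ (M ⊓ LinearMap.ker (centralMul V e hc)).restrictScalars K = M.restrictScalars K := by
    apply le_antisymm
    · exact sup_le (fun _ h => h.1) (fun _ h => h.1)
    · intro m hm
      refine Submodule.mem_sup.2 ⟨e • m, ⟨M.smul_mem e hm, m, rfl⟩, m - e • m,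
        ⟨M.sub_mem hm (M.smul_mem e hm), ?_⟩, by abel⟩
      change e • (m - e • m) = 0
      rw [smul_sub, smul_smul, he, sub_self]
  have h2 : (M ⊓ LinearMap.range (centralMul V e hc)).restrictScalars K
      ⊓ (M ⊓ LinearMap.ker (centralMul V e hc)).restrictScalars K = ⊥ := by
    rw [eq_bot_iff]
    rintro _ ⟨⟨-, m, rfl⟩, -, h⟩
    have h' : e • (e • m) = 0 := h
    rw [smul_smul, he] at h'
    exact h'
  rw [h1, h2, finrank_bot, add_zero] at h
  exact h

theorem exists_fin_span_eq [FiniteDimensional K V] {r : ℕ} (U : Submodule K V)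
    (hU : finrank K U ≤ r) : ∃ u : Fin r → V, Submodule.span K (Set.range u) = U := by
  let b := finBasis K U
  refine ⟨fun i => if h : (i : ℕ) < finrank K U then (b ⟨i, h⟩ : V) else 0, le_antisymm ?_ ?_⟩
  · rw [Submodule.span_le]
    rintro _ ⟨i, rfl⟩
    dsimp only
    split_ifs
    · exact (b _).2
    · exact U.zero_mem
  · have h1 : Submodule.span K (Set.range fun i => (b i : V)) = U := by
      have := congrArg (Submodule.map U.subtype) b.span_eq
      rw [Submodule.map_span, Submodule.map_top, Submodule.range_subtype, ← Set.range_comp] at this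
      exact this
    conv_lhs => rw [← h1]
    rw [Submodule.span_le]
    rintro _ ⟨i, rfl⟩
    refine Submodule.subset_span ⟨⟨i, i.2.trans_le hU⟩, ?_⟩
    simp

/-- Generators of the two summands are added in pairs; multiplication by e recovers u_i from u_i +
f_i. -/
theorem isRGenerated_sup [FiniteDimensional K V] (he : e * e = e) {r : ℕ} {U Q : Submodule A V}
    (hU : U ≤ LinearMap.range (centralMul V e hc)) (hUr : finrank K U ≤ r)
    (hQ : Q ≤ LinearMap.ker (centralMul V e hc)) (hQr : IsRGenerated A Q r) :
    IsRGenerated A (U ⊔ Q : Submodule A V) r := by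
  obtain ⟨f, hf⟩ := isRGenerated_submodule_iff.1 hQr
  obtain ⟨u, hu⟩ := exists_fin_span_eq (U.restrictScalars K) hUr
  have huU : ∀ i, u i ∈ U := fun i => by
    have : u i ∈ U.restrictScalars K := hu ▸ Submodule.subset_span ⟨i, rfl⟩
    exact this
  have hfQ : ∀ i, f i ∈ Q := fun i => hf ▸ Submodule.subset_span ⟨i, rfl⟩
  rw [isRGenerated_submodule_iff]
  refine ⟨fun i => u i + f i, le_antisymm ?_ ?_⟩
  · rw [Submodule.span_le]
    rintro _ ⟨i, rfl⟩
    exact Submodule.add_mem_sup (huU i) (hfQ i)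
  · set N := Submodule.span A (Set.range fun i => u i + f i) with hN
    have h1 : ∀ i, u i + f i ∈ N := fun i => Submodule.subset_span ⟨i, rfl⟩
    have h2 : ∀ i, u i ∈ N := by
      intro i
      have h := N.smul_mem e (h1 i)
      obtain ⟨w, hw⟩ := hU (huU i)
      have h3 : e • f i = 0 := hQ (hfQ i)
      have h4 : e • u i = u i := by
        rw [← hw, centralMul_apply, smul_smul, he]
      rwa [smul_add, h3, h4, add_zero] at h
    refine sup_le ?_ ?_
    · have h3 : U.restrictScalars K ≤ N.restrictScalars K := by
        rw [← hu, Submodule.span_le]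
        rintro _ ⟨i, rfl⟩
        exact h2 i
      exact h3
    · rw [← hf, Submodule.span_le]
      rintro _ ⟨i, rfl⟩
      have h := N.sub_mem (h1 i) (h2 i)
      rwa [add_sub_cancel_left] at h

/-- A maximal `r`-generated submodule has the expected dimension if and only if the kernel of the
idempotent `e` is `r`-generated. -/
theorem finrank_maximal_iff [FiniteDimensional K V] (he : e * e = e)
    (hε : ∀ a, ∃ k : K, a * e = k • e) {r : ℕ} {M : Submodule A V}
    (hM : IsMaximalRGenerated r M)
    (hr : r ≤ finrank K (LinearMap.range (centralMul V e hc))) :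
    (finrank K M : ℤ) = (finrank K V : ℤ)
        - ((finrank K (LinearMap.range (centralMul V e hc)) : ℤ) - (r : ℤ))
      ↔ IsRGenerated A (LinearMap.ker (centralMul V e hc)) r := by
  obtain ⟨hMr, hmax⟩ := hM
  set I := LinearMap.range (centralMul V e hc) with hI
  set Z := LinearMap.ker (centralMul V e hc) with hZ
  have h1 : finrank K (M ⊓ I : Submodule A V) ≤ r := finrank_inf_range_le he hε hMr
  have h2 : IsRGenerated A (M ⊓ Z : Submodule A V) r := isRGenerated_inf_ker he hMr
  have hMdim := finrank_eq_inf_range_add_inf_ker (K := K) (hc := hc) he M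
  have hVdim := finrank_eq_inf_range_add_inf_ker (K := K) (hc := hc) he (⊤ : Submodule A V)
  rw [top_inf_eq, top_inf_eq, ← hI, ← hZ] at hVdim
  rw [← hI, ← hZ] at hMdim
  have htop : finrank K (⊤ : Submodule A V) = finrank K V := finrank_top K V
  rw [htop] at hVdim
  have hsup : M = (M ⊓ I) ⊔ (M ⊓ Z) := by
    apply le_antisymm
    · intro m hm
      refine Submodule.mem_sup.2 ⟨e • m, ⟨M.smul_mem e hm, m, rfl⟩, m - e • m,
        ⟨M.sub_mem hm (M.smul_mem e hm), ?_⟩, by abel⟩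
      change e • (m - e • m) = 0
      rw [smul_sub, smul_smul, he, sub_self]
    · exact sup_le inf_le_left inf_le_left
  -- If the intersection were smaller, a line K v with v in I outside M could be added without
  -- raising the number of generators.
  have h3 : finrank K (M ⊓ I : Submodule A V) = r := by
    by_contra hne
    have hlt : finrank K (M ⊓ I : Submodule A V) < r := lt_of_le_of_ne h1 hne
    have hIM : ¬I ≤ M := by
      intro hle
      rw [inf_eq_right.2 hle] at hlt
      omega
    obtain ⟨v, hvI, hvM⟩ := SetLike.not_le_iff_exists.1 hIM
    let L : Submodule A V :=
      { carrier := {w | ∃ k : K, w = k • v}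
        zero_mem' := ⟨0, by simp⟩
        add_mem' := by
          rintro _ _ ⟨k, rfl⟩ ⟨l, rfl⟩
          exact ⟨k + l, (add_smul k l v).symm⟩
        smul_mem' := by
          rintro a _ ⟨k, rfl⟩
          obtain ⟨w, rfl⟩ := hvI
          obtain ⟨l, hl⟩ := hε a
          refine ⟨l * k, ?_⟩
          rw [centralMul_apply, smul_algebra_smul_comm, smul_smul a e w, hl, smul_assoc, smul_smul,
            mul_comm] }
    have hLI : L ≤ I := by
      rintro _ ⟨k, rfl⟩
      exact I.smul_of_tower_mem k hvI
    have hLdim : finrank K (L.restrictScalars K) ≤ 1 := by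
      have : L.restrictScalars K = Submodule.span K {v} := by
        ext w
        rw [Submodule.mem_span_singleton]
        exact ⟨fun ⟨k, hk⟩ => ⟨k, hk.symm⟩, fun ⟨k, hk⟩ => ⟨k, hk.symm⟩⟩
      rw [this]
      exact (finrank_span_le_card ({v} : Set V)).trans (by simp)
    have hdim : finrank K ((M ⊓ I) ⊔ L : Submodule A V) ≤ r := by
      have h4 := Submodule.finrank_add_le_finrank_add_finrank
        ((M ⊓ I).restrictScalars K) (L.restrictScalars K)
      rw [← Submodule.restrictScalars_sup] at h4
      have h5 : finrank K ((M ⊓ I).restrictScalars K) < r := hlt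
      exact h4.trans (by omega)
    have h6 := isRGenerated_sup (hc := hc) he (sup_le inf_le_right hLI) hdim inf_le_right h2
    have h7 := hmax _ h6 (by
      conv_lhs => rw [hsup]
      exact sup_le_sup_right le_sup_left _)
    apply hvM
    rw [← h7]
    exact Submodule.mem_sup_left (Submodule.mem_sup_right ⟨1, (one_smul K v).symm⟩)
  constructor
  · intro h
    have h4 : finrank K (M ⊓ Z : Submodule A V) = finrank K Z := by omega
    have h5 : M ⊓ Z = Z := by
      apply Submodule.restrictScalars_injective K
      exact Submodule.eq_of_le_of_finrank_eq (fun _ h => h.2) h4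
    rwa [h5] at h2
  · intro h
    have h4 := isRGenerated_sup (hc := hc) he (U := M ⊓ I) inf_le_right h1 le_rfl h
    have h5 := hmax _ h4 (by
      conv_lhs => rw [hsup]
      exact sup_le_sup_left inf_le_right _)
    have h6 : M ⊓ Z = Z := by
      apply inf_eq_right.2
      rw [← h5]
      exact le_sup_right
    rw [h6] at hMdim
    omega

end TrivialPart

/-! ### Exponent vectors and partitions. -/

section PartitionRepresentatives

open Finset

/-- Two functions on a finite type with the same multiset of values differ by a permutation. -/
theorem exists_perm_of_map_univ_eq {α β : Type*} [Fintype α] [DecidableEq β] {f g : α → β}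
    (h : (univ : Finset α).val.map f = (univ : Finset α).val.map g) :
    ∃ σ : Equiv.Perm α, ∀ a, g (σ a) = f a := by
  have hc : ∀ b, Nonempty ({a // f a = b} ≃ {a // g a = b}) := by
    intro b
    rw [← Fintype.card_eq, Fintype.card_subtype, Fintype.card_subtype]
    have h1 := congrArg (Multiset.count b) h
    rw [Multiset.count_map, Multiset.count_map] at h1
    simpa [Finset.card, Finset.filter_val, eq_comm] using h1
  exact ⟨Equiv.ofFiberEquiv fun b => (hc b).some, fun a => Equiv.ofFiberEquiv_map _ a⟩

theorem Nat.Partition.card_parts_le {d : ℕ} (p : Nat.Partition d) : p.parts.card ≤ d := by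
  have h := Multiset.card_nsmul_le_sum (s := p.parts) (a := 1) fun x hx => p.parts_pos hx
  rwa [smul_eq_mul, mul_one, p.parts_sum] at h

theorem exists_map_univ_eq {β : Type*} {n : ℕ} (s : Multiset β) (hs : s.card = n) :
    ∃ f : Fin n → β, (univ : Finset (Fin n)).val.map f = s := by
  subst hs
  induction s using Quotient.inductionOn with
  | h l =>
    refine ⟨l.get, ?_⟩
    exact (Fin.univ_val_map l.get).trans (by rw [List.ofFn_get]; rfl)

variable {n d : ℕ}

theorem exists_partition_representative (h : d ≤ n) (p : Nat.Partition d) :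
    ∃ x : Fin n →₀ ℕ, (univ : Finset (Fin n)).val.map x
      = p.parts + Multiset.replicate (n - p.parts.card) 0 := by
  obtain ⟨f, hf⟩ := exists_map_univ_eq (n := n)
    (p.parts + Multiset.replicate (n - p.parts.card) 0) (by
      have := p.card_parts_le
      rw [Multiset.card_add, Multiset.card_replicate]
      omega)
  exact ⟨Finsupp.equivFunOnFinite.symm f, hf⟩

/-- An exponent vector whose nonzero entries are the parts of `p`. -/
noncomputable def partitionRep (h : d ≤ n) (p : Nat.Partition d) : Fin n →₀ ℕ :=
  (exists_partition_representative h p).choose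

theorem map_partitionRep (h : d ≤ n) (p : Nat.Partition d) :
    (univ : Finset (Fin n)).val.map (partitionRep h p)
      = p.parts + Multiset.replicate (n - p.parts.card) 0 :=
  (exists_partition_representative h p).choose_spec

theorem degree_partitionRep (h : d ≤ n) (p : Nat.Partition d) : (partitionRep h p).degree = d := by
  have h1 := congrArg Multiset.sum (map_partitionRep h p)
  rw [Multiset.sum_add, Multiset.sum_replicate, smul_zero, add_zero, p.parts_sum] at h1
  rw [Finsupp.degree_eq_sum]
  exact h1

/-- The partition of `d` formed by the nonzero exponents of an exponent vector of degree `d`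
(and a default value for other degrees). -/
noncomputable def exponentPartition (d : ℕ) (x : Fin n →₀ ℕ) : Nat.Partition d :=
  if h : x.degree = d then
    Nat.Partition.ofSums d ((univ : Finset (Fin n)).val.map x) (by
      rw [← h, Finsupp.degree_eq_sum]; rfl)
  else Nat.Partition.indiscrete d

theorem exponentPartition_parts {x : Fin n →₀ ℕ} (h : x.degree = d) :
    (exponentPartition d x).parts = ((univ : Finset (Fin n)).val.map x).filter (· ≠ 0) := by
  rw [exponentPartition, dif_pos h]
  rfl

theorem exponentPartition_partitionRep (h : d ≤ n) (p : Nat.Partition d) :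
    exponentPartition d (partitionRep h p) = p := by
  apply Nat.Partition.ext
  rw [exponentPartition_parts (degree_partitionRep h p), map_partitionRep, Multiset.filter_add,
    Multiset.filter_eq_self.2 fun a ha => (p.parts_pos ha).ne', Multiset.filter_eq_nil.2,
    add_zero]
  intro a ha
  simp [Multiset.eq_of_mem_replicate ha]

theorem exists_perm_partitionRep (h : d ≤ n) {x : Fin n →₀ ℕ} (hx : x.degree = d) :
    ∃ σ : Equiv.Perm (Fin n), (partitionRep h (exponentPartition d x)).mapDomain σ = x := by
  have h1 : (univ : Finset (Fin n)).val.map (partitionRep h (exponentPartition d x))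
      = (univ : Finset (Fin n)).val.map x := by
    rw [map_partitionRep, exponentPartition_parts hx]
    set s := (univ : Finset (Fin n)).val.map x with hs
    have hcard : s.card = n := by simp [hs]
    have h2 := Multiset.filter_add_not (· ≠ 0) s
    have h3 : s.filter (fun a => ¬a ≠ 0) = Multiset.replicate (n - (s.filter (· ≠ 0)).card) 0 := by
      rw [Multiset.eq_replicate]
      refine ⟨?_, fun b hb => by simpa using (Multiset.mem_filter.1 hb).2⟩
      have := congrArg Multiset.card h2
      rw [Multiset.card_add, hcard] at this
      omega
    rw [← h3, h2]
  obtain ⟨σ, hσ⟩ := exists_perm_of_map_univ_eq h1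
  refine ⟨σ, ?_⟩
  ext i
  have h4 := Finsupp.mapDomain_apply σ.injective (partitionRep h (exponentPartition d x)) (σ⁻¹ i)
  rw [← hσ] at h4
  have h5 : σ (σ⁻¹ i) = i := σ.apply_symm_apply i
  rwa [h5] at h4

theorem mapDomain_perm_apply (σ : Equiv.Perm (Fin n)) (x : Fin n →₀ ℕ) (i : Fin n) :
    x.mapDomain σ i = x (σ⁻¹ i) := by
  have h4 := Finsupp.mapDomain_apply σ.injective x (σ⁻¹ i)
  have h5 : σ (σ⁻¹ i) = i := σ.apply_symm_apply i
  rwa [h5] at h4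

theorem degree_mapDomain_perm (σ : Equiv.Perm (Fin n)) (x : Fin n →₀ ℕ) :
    (x.mapDomain σ).degree = x.degree := by
  rw [Finsupp.degree_eq_sum, Finsupp.degree_eq_sum]
  simp only [mapDomain_perm_apply]
  exact Equiv.sum_comp σ⁻¹ x

theorem exponentPartition_mapDomain (σ : Equiv.Perm (Fin n)) (x : Fin n →₀ ℕ) :
    exponentPartition d (x.mapDomain σ) = exponentPartition d x := by
  by_cases h : x.degree = d
  · apply Nat.Partition.ext
    rw [exponentPartition_parts h, exponentPartition_parts ((degree_mapDomain_perm σ x).trans h)]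
    congr 1
    have h1 : (x.mapDomain σ : Fin n → ℕ) = x ∘ (σ⁻¹ : Equiv.Perm (Fin n)) :=
      funext (mapDomain_perm_apply σ x)
    have h2 : (univ : Finset (Fin n)).val.map (σ⁻¹ : Equiv.Perm (Fin n)) = univ.val :=
      congrArg Finset.val (Finset.map_univ_equiv (σ⁻¹ : Equiv.Perm (Fin n)))
    rw [h1, ← Multiset.map_map, h2]
  · rw [exponentPartition, exponentPartition, dif_neg h,
      dif_neg (by rwa [degree_mapDomain_perm])]

theorem image_partitionRep (h : d < n) (p : Nat.Partition d) :
    univ.image (partitionRep h.le p) = insert 0 p.parts.toFinset := by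
  have h1 := map_partitionRep h.le p
  have h2 := p.card_parts_le
  ext v
  have h3 : v ∈ univ.image (partitionRep h.le p)
      ↔ v ∈ (univ : Finset (Fin n)).val.map (partitionRep h.le p) := by
    simp
  rw [h3, h1, Multiset.mem_add, Multiset.mem_replicate, mem_insert, Multiset.mem_toFinset]
  constructor
  · rintro (h | h)
    · exact Or.inr h
    · exact Or.inl h.2
  · rintro (h | h)
    · exact Or.inr ⟨by omega, h⟩
    · exact Or.inl h

theorem zero_notMem_parts (p : Nat.Partition d) : 0 ∉ p.parts.toFinset := by
  rw [Multiset.mem_toFinset]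
  exact fun h => (p.parts_pos h).ne' rfl

/-- The extra value is the exponent 0, which occurs because a partition of d has at most d < n
parts. -/
theorem card_image_partitionRep (h : d < n) (p : Nat.Partition d) :
    (univ.image (partitionRep h.le p)).card = p.parts.toFinset.card + 1 := by
  rw [image_partitionRep h, card_insert_of_notMem (zero_notMem_parts p)]

/-- If every exponent of `x` occurs exactly twice, including zero, and the degree is less than
the number of variables, then there are two or four variables. -/
theorem eq_four_of_card_fibers_eq_two {x : Fin n → ℕ} (hd : ∑ i, x i < n)
    (h2 : ∀ v ∈ univ.image x, (univ.filter (x · = v)).card = 2) (h0 : 1 < (univ.image x).card) :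
    n = 4 ∧ ∑ i, x i = 2 := by
  have hn : n = 2 * (univ.image x).card := by
    have h := card_eq_sum_card_image x univ
    rw [sum_congr rfl h2, sum_const, card_univ, Fintype.card_fin, smul_eq_mul] at h
    omega
  have hs : ∑ i, x i = 2 * ∑ v ∈ univ.image x, v := by
    have h := sum_comp (s := univ) (fun v : ℕ => v) x
    rw [h, mul_sum]
    exact sum_congr rfl fun v hv => by rw [h2 v hv, smul_eq_mul]
  -- The distinct values sum to less than their number, which forces them to be 0 and 1.
  have h1 : ∑ v ∈ univ.image x, v < (univ.image x).card := by omega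
  have hle : (univ.image x).erase 0 ⊆ {1} := by
    have h3 : ∑ v ∈ (univ.image x).erase 0, v ≤ ∑ v ∈ (univ.image x).erase 0, 1 := by
      have h4 : ∑ v ∈ (univ.image x).erase 0, v = ∑ v ∈ univ.image x, v :=
        sum_erase _ rfl
      have h5 : (univ.image x).card ≤ ((univ.image x).erase 0).card + 1 := by
        have := pred_card_le_card_erase (s := univ.image x) (a := 0)
        omega
      rw [h4, sum_const, smul_eq_mul, mul_one]
      omega
    have h6 : ∀ v ∈ (univ.image x).erase 0, 1 ≤ v := fun v hv =>
      Nat.one_le_iff_ne_zero.2 (mem_erase.1 hv).1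
    have h7 := (sum_eq_sum_iff_of_le h6).1 (le_antisymm (sum_le_sum h6) h3)
    exact fun v hv => mem_singleton.2 (h7 v hv).symm
  have h8 : (univ.image x).card ≤ 2 := by
    have := pred_card_le_card_erase (s := univ.image x) (a := 0)
    have h9 := card_le_card hle
    rw [card_singleton] at h9
    omega
  have h9 : (univ.image x).card = 2 := by omega
  have h10 : ∑ v ∈ univ.image x, v = 1 := by
    have h4 : ∑ v ∈ (univ.image x).erase 0, v = ∑ v ∈ univ.image x, v :=
      sum_erase _ rfl
    have h11 : (univ.image x).erase 0 = {1} := by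
      apply eq_of_subset_of_card_le hle
      have := pred_card_le_card_erase (s := univ.image x) (a := 0)
      rw [card_singleton]
      omega
    rw [← h4, h11, sum_singleton]
  omega

/-- The numbers of distinct parts of the partitions of `d` add up to `∑_{i < d} P(i)`. -/
theorem sum_card_toFinset_parts (d : ℕ) :
    ∑ p : Nat.Partition d, p.parts.toFinset.card = ∑ i ∈ range d, numPartitions i := by
  have h1 : ∀ p : Nat.Partition d, p.parts.toFinset.card
      = ∑ b ∈ Icc 1 d, if b ∈ p.parts then 1 else 0 := by
    intro p
    rw [← card_filter]
    congr 1
    ext b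
    rw [Multiset.mem_toFinset, mem_filter, mem_Icc]
    exact ⟨fun h => ⟨⟨p.parts_pos h, p.le_of_mem_parts h⟩, h⟩, fun h => h.2⟩
  -- Removing one copy of b matches the partitions of d containing b with the partitions of d - b.
  have h2 : ∀ b ∈ Icc 1 d, (∑ p : Nat.Partition d, if b ∈ p.parts then 1 else 0)
      = numPartitions (d - b) := by
    intro b hb
    rw [mem_Icc] at hb
    rw [← card_filter, ← Fintype.card_subtype, numPartitions]
    exact Fintype.card_congr (Nat.Partition.partitionWithPartEquiv hb.1 hb.2)
  rw [sum_congr rfl fun p _ => h1 p, sum_comm, sum_congr rfl h2]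
  refine sum_nbij' (fun b => d - b) (fun i => d - i) ?_ ?_ ?_ ?_ ?_
  · intro b hb; rw [mem_Icc] at hb; rw [mem_range]; omega
  · intro i hi; rw [mem_range] at hi; rw [mem_Icc]; omega
  · intro b hb; rw [mem_Icc] at hb; omega
  · intro i hi; rw [mem_range] at hi; omega
  · intro b _; rfl

end PartitionRepresentatives

/-! ### Permutation modules on exponent vectors. -/

section MonomialModules

open Finset Module

set_option linter.unusedSectionVars false

theorem mapDomain_mapDomain_inv {n : ℕ} (σ : Equiv.Perm (Fin n)) (x : Fin n →₀ ℕ) :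
    (x.mapDomain (σ⁻¹ : Equiv.Perm (Fin n))).mapDomain σ = x := by
  ext i
  rw [mapDomain_perm_apply, mapDomain_perm_apply, inv_inv]
  exact congrArg x (σ.apply_symm_apply i)

/-- The exponent vectors of degree `d`. -/
noncomputable def exponents (n d : ℕ) : Finset (Fin n →₀ ℕ) :=
  (univ : Finset (Fin n)).finsuppAntidiag d

theorem mem_exponents {n d : ℕ} {x : Fin n →₀ ℕ} : x ∈ exponents n d ↔ x.degree = d := by
  rw [exponents, mem_finsuppAntidiag, Finsupp.degree_eq_sum]
  simp

variable {K : Type*} [Field K] {n d : ℕ} {V : Type*} [AddCommGroup V] [Module K V]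
  [Module (MonoidAlgebra K (Equiv.Perm (Fin n))) V]
  [IsScalarTower K (MonoidAlgebra K (Equiv.Perm (Fin n))) V]

/-- The module `V` is a permutation module on the exponent vectors of degree `d`: it has vectors
`mono x` and linear forms `coeff x` that behave like monomials and coefficients. -/
structure IsMonomialModule (d : ℕ) (coeff : (Fin n →₀ ℕ) → V →ₗ[K] K) (mono : (Fin n →₀ ℕ) → V) :
    Prop where
  coeff_mono : ∀ x : Fin n →₀ ℕ, x.degree = d → ∀ y, coeff y (mono x) = if x = y then 1 else 0
  ext : ∀ v w : V, (∀ x : Fin n →₀ ℕ, x.degree = d → coeff x v = coeff x w) → v = w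
  coeff_smul : ∀ (σ : Equiv.Perm (Fin n)) (x : Fin n →₀ ℕ) (v : V),
    coeff (x.mapDomain σ) (MonoidAlgebra.single σ (1 : K) • v) = coeff x v

variable {coeff : (Fin n →₀ ℕ) → V →ₗ[K] K} {mono : (Fin n →₀ ℕ) → V}

namespace IsMonomialModule

theorem coeff_smul' (h : IsMonomialModule d coeff mono) (σ : Equiv.Perm (Fin n)) (x : Fin n →₀ ℕ)
    (v : V) : coeff x (MonoidAlgebra.single σ (1 : K) • v)
      = coeff (x.mapDomain (σ⁻¹ : Equiv.Perm (Fin n))) v := by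
  conv_lhs => rw [← mapDomain_mapDomain_inv σ x]
  exact h.coeff_smul σ _ v

theorem single_smul_mono (h : IsMonomialModule d coeff mono) (σ : Equiv.Perm (Fin n))
    {x : Fin n →₀ ℕ} (hx : x.degree = d) :
    MonoidAlgebra.single σ (1 : K) • mono x = mono (x.mapDomain σ) := by
  refine h.ext _ _ fun y _ => ?_
  rw [h.coeff_smul', h.coeff_mono x hx, h.coeff_mono _ ((degree_mapDomain_perm σ x).trans hx)]
  refine if_congr ⟨?_, ?_⟩ rfl rfl
  · rintro rfl
    exact mapDomain_mapDomain_inv σ y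
  · rintro rfl
    have := mapDomain_mapDomain_inv σ⁻¹ x
    rw [inv_inv] at this
    exact this.symm

theorem eq_sum (h : IsMonomialModule d coeff mono) (v : V) :
    v = ∑ x ∈ exponents n d, coeff x v • mono x := by
  refine h.ext _ _ fun y hy => ?_
  rw [map_sum, sum_eq_single y]
  · rw [map_smul, h.coeff_mono y hy, if_pos rfl, smul_eq_mul, mul_one]
  · intro x hx hxy
    rw [map_smul, h.coeff_mono x (mem_exponents.1 hx), if_neg hxy, smul_zero]
  · intro h
    exact absurd (mem_exponents.2 hy) h

end IsMonomialModule

end MonomialModules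

/-! ### The averaging idempotent of a group algebra. -/

section Average

open Finset

variable (K : Type*) [Field K]

variable (G : Type*) [Group G] [Fintype G] [Invertible (Fintype.card G : K)]

open GroupAlgebra

theorem exists_mul_average_eq (a : MonoidAlgebra K G) :
    ∃ k : K, a * average K G = k • average K G := by
  induction a using MonoidAlgebra.induction_on with
  | of g => exact ⟨1, by rw [one_smul, MonoidAlgebra.of_apply, mul_average_left]⟩
  | add a b ha hb =>
    obtain ⟨k, hk⟩ := ha
    obtain ⟨l, hl⟩ := hb
    exact ⟨k + l, by rw [add_mul, hk, hl, add_smul]⟩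
  | smul r a ha =>
    obtain ⟨k, hk⟩ := ha
    exact ⟨r * k, by rw [smul_mul_assoc, hk, smul_smul]⟩

theorem mul_average_comm (a : MonoidAlgebra K G) : a * average K G = average K G * a := by
  induction a using MonoidAlgebra.induction_on with
  | of g => rw [MonoidAlgebra.of_apply, mul_average_left, mul_average_right]
  | add a b ha hb => rw [add_mul, mul_add, ha, hb]
  | smul r a ha => rw [smul_mul_assoc, mul_smul_comm, ha]

variable {G} {V : Type*} [AddCommGroup V] [Module (MonoidAlgebra K G) V]

theorem single_smul_average_smul (g : G) (v : V) :
    MonoidAlgebra.single g (1 : K) • (average K G • v) = average K G • v := by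
  rw [smul_smul, mul_average_left]

variable [Module K V] [IsScalarTower K (MonoidAlgebra K G) V]

theorem average_smul_of_invariant {v : V} (h : ∀ g : G, MonoidAlgebra.single g (1 : K) • v = v) :
    average K G • v = v := by
  rw [average, smul_assoc, Finset.sum_smul, sum_congr rfl fun g _ => by
    rw [MonoidAlgebra.of_apply, h g], sum_const, card_univ, ← Nat.cast_smul_eq_nsmul K, smul_smul,
    invOf_mul_self, one_smul]

theorem average_mul_average : average K G * average K G = average K G :=
  average_smul_of_invariant (V := MonoidAlgebra K G) K fun g => mul_average_left K G g

end Average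

/-! ### Counting invariants, and the lower bound on the number of generators. -/

section InvariantCount

open Finset Module GroupAlgebra

set_option linter.unusedSectionVars false

variable {K : Type*} [Field K] {n d : ℕ} {V : Type*} [AddCommGroup V] [Module K V]
  [Module (MonoidAlgebra K (Equiv.Perm (Fin n))) V]
  [IsScalarTower K (MonoidAlgebra K (Equiv.Perm (Fin n))) V]
  [Invertible (Fintype.card (Equiv.Perm (Fin n)) : K)]
  {coeff : (Fin n →₀ ℕ) → V →ₗ[K] K} {mono : (Fin n →₀ ℕ) → V}

variable (K n V) in
/-- The invariants of the symmetric group. -/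
noncomputable abbrev symmInvariants : Submodule (MonoidAlgebra K (Equiv.Perm (Fin n))) V :=
  LinearMap.range (centralMul V (average K (Equiv.Perm (Fin n))) (mul_average_comm K _))

variable (K n V) in
/-- The vectors whose average over the symmetric group is zero. -/
noncomputable abbrev averageZero : Submodule (MonoidAlgebra K (Equiv.Perm (Fin n))) V :=
  LinearMap.ker (centralMul V (average K (Equiv.Perm (Fin n))) (mul_average_comm K _))

theorem mem_symmInvariants {v : V} :
    v ∈ symmInvariants K n V ↔
      ∀ σ : Equiv.Perm (Fin n), MonoidAlgebra.single σ (1 : K) • v = v := by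
  constructor
  · rintro ⟨w, rfl⟩ σ
    exact single_smul_average_smul K σ w
  · intro h
    exact ⟨v, average_smul_of_invariant K h⟩

theorem mem_averageZero {v : V} :
    v ∈ averageZero K n V ↔ average K (Equiv.Perm (Fin n)) • v = 0 := Iff.rfl

/-- Invariance means that coefficients are constant on orbits of exponent vectors, and the orbits
are indexed by partitions. -/
theorem finrank_symmInvariants [FiniteDimensional K V] (hV : IsMonomialModule d coeff mono)
    (h : d ≤ n) :
    finrank K (symmInvariants K n V) = numPartitions d := by
  have hcard : finrank K (Nat.Partition d → K) = numPartitions d := finrank_fintype_fun_eq_card K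
  rw [← hcard]
  apply le_antisymm
  · let f : (symmInvariants K n V).restrictScalars K →ₗ[K] (Nat.Partition d → K) :=
      LinearMap.pi fun p => (coeff (partitionRep h p)).comp
        ((symmInvariants K n V).restrictScalars K).subtype
    suffices hf : Function.Injective f from LinearMap.finrank_le_finrank_of_injective hf
    refine (injective_iff_map_eq_zero f).2 ?_
    rintro ⟨v, hv⟩ hf
    apply Subtype.ext
    refine hV.ext _ _ fun x hx => ?_
    obtain ⟨σ, hσ⟩ := exists_perm_partitionRep h hx
    have h1 := mem_symmInvariants.1 hv σ
    have h2 : coeff (partitionRep h (exponentPartition d x)) v = 0 :=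
      congrFun hf (exponentPartition d x)
    change coeff x v = coeff x 0
    rw [map_zero, ← h2, ← hV.coeff_smul σ (partitionRep h (exponentPartition d x)) v,
      h1, hσ]
  · let g : (Nat.Partition d → K) →ₗ[K] V :=
      ∑ x ∈ exponents n d, (LinearMap.proj (exponentPartition d x)).smulRight (mono x)
    have hg : ∀ c, g c = ∑ x ∈ exponents n d, c (exponentPartition d x) • mono x := by
      intro c
      simp [g]
    have hcoeff : ∀ c, ∀ y : Fin n →₀ ℕ, y.degree = d →
        coeff y (g c) = c (exponentPartition d y) := by
      intro c y hy
      rw [hg, map_sum, sum_eq_single y]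
      · rw [map_smul, hV.coeff_mono y hy, if_pos rfl, smul_eq_mul, mul_one]
      · intro x hx hxy
        rw [map_smul, hV.coeff_mono x (mem_exponents.1 hx), if_neg hxy, smul_zero]
      · intro h
        exact absurd (mem_exponents.2 hy) h
    have hmem : ∀ c, g c ∈ (symmInvariants K n V).restrictScalars K := by
      intro c
      refine mem_symmInvariants.2 fun σ => hV.ext _ _ fun y hy => ?_
      rw [hV.coeff_smul', hcoeff c y hy, hcoeff c _ ((degree_mapDomain_perm _ y).trans hy),
        exponentPartition_mapDomain]
    have : FiniteDimensional K (symmInvariants K n V) :=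
      inferInstanceAs (FiniteDimensional K ((symmInvariants K n V).restrictScalars K))
    suffices hinj : Function.Injective
        (g.codRestrict ((symmInvariants K n V).restrictScalars K) hmem) from
      LinearMap.finrank_le_finrank_of_injective hinj
    intro c c' hcc
    funext p
    have h1 : g c = g c' := congrArg Subtype.val hcc
    have h2 := hcoeff c _ (degree_partitionRep h p)
    rw [h1, hcoeff c' _ (degree_partitionRep h p), exponentPartition_partitionRep] at h2
    exact h2.symm

/-- The linear form `f ↦ ∑ₓ f_x c(type of x, x_j)`. -/
noncomputable def typeForm (coeff : (Fin n →₀ ℕ) → V →ₗ[K] K) (c : Nat.Partition d → ℕ → K)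
    (j : Fin n) : V →ₗ[K] K :=
  ∑ x ∈ exponents n d, c (exponentPartition d x) (x j) • coeff x

theorem IsMonomialModule.typeForm_mono (hV : IsMonomialModule d coeff mono)
    (c : Nat.Partition d → ℕ → K) (j : Fin n) {x : Fin n →₀ ℕ}
    (hx : x.degree = d) :
    typeForm coeff c j (mono x) = c (exponentPartition d x) (x j) := by
  rw [typeForm, LinearMap.sum_apply, sum_eq_single x]
  · rw [LinearMap.smul_apply, hV.coeff_mono x hx, if_pos rfl, smul_eq_mul, mul_one]
  · intro y _ hyx
    rw [LinearMap.smul_apply, hV.coeff_mono x hx, if_neg hyx.symm, smul_zero]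
  · intro h
    exact absurd (mem_exponents.2 hx) h

theorem IsMonomialModule.typeForm_smul (hV : IsMonomialModule d coeff mono)
    (c : Nat.Partition d → ℕ → K) (j : Fin n) (σ : Equiv.Perm (Fin n))
    (v : V) :
    typeForm coeff c j (MonoidAlgebra.single σ (1 : K) • v) = typeForm coeff c (σ⁻¹ j) v := by
  rw [hV.eq_sum v, smul_sum, map_sum, map_sum]
  refine sum_congr rfl fun x hx => ?_
  rw [mem_exponents] at hx
  rw [smul_algebra_smul_comm, hV.single_smul_mono σ hx, map_smul, map_smul,
    hV.typeForm_mono c j ((degree_mapDomain_perm σ x).trans hx),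
    hV.typeForm_mono c _ hx, exponentPartition_mapDomain, mapDomain_perm_apply]

/-- Differences of the forms `typeForm` encode equivariant maps to the standard module. The
coefficient functions on pairs (p, b) inject into the values of these differences at r generators.
-/
theorem sum_card_parts_le_of_isRGenerated (hV : IsMonomialModule d coeff mono)
    (h : d < n) {r : ℕ}
    (hr : IsRGenerated (MonoidAlgebra K (Equiv.Perm (Fin n))) (averageZero K n V) r) :
    ∑ p : Nat.Partition d, p.parts.toFinset.card ≤ r * (n - 1) := by
  obtain ⟨f, hf⟩ := isRGenerated_submodule_iff.1 hr
  let j₀ : Fin n := ⟨0, by omega⟩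
  let Fam := (p : Nat.Partition d) × {b // b ∈ p.parts.toFinset}
  -- Setting the value at exponent 0 to zero removes the functions constant in the exponent, whose
  -- differences vanish identically.
  let ext : (Fam → K) → Nat.Partition d → ℕ → K := fun c p b =>
    if hb : b ∈ p.parts.toFinset then c ⟨p, b, hb⟩ else 0
  have hext0 : ∀ c p, ext c p 0 = 0 := fun c p => dif_neg (zero_notMem_parts p)
  let L : (Fam → K) →ₗ[K] (Fin r × {j : Fin n // j ≠ j₀} → K) :=
    { toFun := fun c ij => typeForm coeff (ext c) ij.2 (f ij.1) - typeForm coeff (ext c) j₀ (f ij.1)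
      map_add' := by
        intro c c'
        have : ext (c + c') = fun p b => ext c p b + ext c' p b := by
          funext p b
          simp only [ext]
          split_ifs <;> simp
        funext ij
        simp only [this, typeForm, add_smul, sum_add_distrib, LinearMap.add_apply, Pi.add_apply]
        ring
      map_smul' := by
        intro k c
        have : ext (k • c) = fun p b => k * ext c p b := by
          funext p b
          simp only [ext]
          split_ifs <;> simp
        funext ij
        simp only [this, typeForm, mul_smul, ← smul_sum, LinearMap.smul_apply, Pi.smul_apply,
          RingHom.id_apply, smul_sub] }
  have hL : Function.Injective L := by
    rw [← LinearMap.ker_eq_bot, LinearMap.ker_eq_bot']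
    intro c hc
    let C : Submodule K (V) :=
      { carrier := {v | ∀ j j', typeForm coeff (ext c) j v = typeForm coeff (ext c) j' v}
        zero_mem' := by simp
        add_mem' := by
          intro a b ha hb j j'
          rw [map_add, map_add, ha j j', hb j j']
        smul_mem' := by
          intro k a ha j j'
          rw [map_smul, map_smul, ha j j'] }
    let C' := MonoidAlgebra.submoduleOfSMulMem C (by
      intro σ v hv j j'
      rw [MonoidAlgebra.of_apply, hV.typeForm_smul, hV.typeForm_smul]
      exact hv _ _)
    have h1 : averageZero K n V ≤ C' := by
      rw [← hf, Submodule.span_le]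
      rintro _ ⟨i, rfl⟩
      have h2 : ∀ j, typeForm coeff (ext c) j (f i) = typeForm coeff (ext c) j₀ (f i) := by
        intro j
        by_cases hj : j = j₀
        · rw [hj]
        · exact sub_eq_zero.1 (congrFun hc (i, ⟨j, hj⟩))
      exact fun j j' => (h2 j).trans (h2 j').symm
    -- The forms agree on Z because its generators lie in the submodule `C'`, and on the invariants
    -- by symmetry. A monomial with exponents b at j and 0 at j' then gives c(p, b) = 0.
    have h3 : ∀ v : V, v ∈ C' := by
      intro v
      have h4 : average K (Equiv.Perm (Fin n)) • v ∈ C' := by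
        intro j j'
        have h5 := hV.typeForm_smul (ext c) j (Equiv.swap j j')
          (average K (Equiv.Perm (Fin n)) • v)
        rw [single_smul_average_smul, Equiv.swap_inv, Equiv.swap_apply_left] at h5
        exact h5
      have h6 : v - average K (Equiv.Perm (Fin n)) • v ∈ C' := by
        apply h1
        rw [mem_averageZero, smul_sub, smul_smul, average_mul_average, sub_self]
      have := C'.add_mem h6 h4
      rwa [sub_add_cancel] at this
    funext q
    obtain ⟨p, b, hb⟩ := q
    have h7 : ∀ v ∈ insert 0 p.parts.toFinset, ∃ j, partitionRep h.le p j = v := by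
      intro v hv
      rw [← image_partitionRep h p, mem_image] at hv
      obtain ⟨j, -, hj⟩ := hv
      exact ⟨j, hj⟩
    obtain ⟨j, hj⟩ := h7 b (mem_insert_of_mem hb)
    obtain ⟨j', hj'⟩ := h7 0 (mem_insert_self _ _)
    have h8 := h3 (mono (partitionRep h.le p)) j j'
    rw [hV.typeForm_mono _ _ (degree_partitionRep h.le p),
      hV.typeForm_mono _ _ (degree_partitionRep h.le p), exponentPartition_partitionRep,
      hj, hj', hext0] at h8
    simp only [ext] at h8
    rwa [dif_pos hb] at h8
  have h9 := LinearMap.finrank_le_finrank_of_injective hL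
  rw [finrank_fintype_fun_eq_card, finrank_fintype_fun_eq_card, Fintype.card_prod,
    Fintype.card_fin, Fintype.card_subtype_compl, Fintype.card_fin, Fintype.card_subtype_eq,
    Fintype.card_sigma] at h9
  simpa only [Fintype.card_coe] using h9

end InvariantCount

/-! ### Summing the bound over all partitions of d. -/

section ColorBound

open Finset Module

set_option linter.unusedSectionVars false

theorem card_filter_partitionRep_eq_zero {n d : ℕ} (h : d ≤ n) (p : Nat.Partition d) :
    (univ.filter (partitionRep h p · = 0)).card = n - p.parts.card := by
  have h1 := congrArg (Multiset.count 0) (map_partitionRep h p)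
  rw [Multiset.count_add, Multiset.count_replicate_self, Multiset.count_map,
    Multiset.count_eq_zero.2 fun h => (p.parts_pos h).ne' rfl, zero_add] at h1
  rw [← h1, Finset.card, Finset.filter_val]
  simp only [eq_comm]

theorem univ_partition_two : (univ : Finset (Nat.Partition 2))
    = {⟨{2}, by simp, by simp⟩, ⟨{1, 1}, by simp, by simp⟩} := by
  refine (eq_univ_iff_forall.2 fun p => ?_).symm
  rw [mem_insert, mem_singleton]
  by_cases h2 : 2 ∈ p.parts
  · left
    obtain ⟨t, ht⟩ := Multiset.exists_cons_of_mem h2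
    have h3 := p.parts_sum
    rw [ht, Multiset.sum_cons] at h3
    have h4 : t = 0 := Multiset.eq_zero_of_forall_notMem fun a ha => by
      have h5 := p.parts_pos (ht ▸ Multiset.mem_cons_of_mem ha)
      have h6 := Multiset.single_le_sum (fun _ _ => Nat.zero_le _) a ha
      omega
    ext1
    rw [ht, h4]
    rfl
  · right
    have h1 : ∀ b ∈ p.parts, b = 1 := fun b hb => by
      have h3 := p.parts_pos hb
      have h4 := (Multiset.single_le_sum (fun _ _ => Nat.zero_le _) b hb).trans_eq p.parts_sum
      have h5 : b ≠ 2 := fun h => h2 (h ▸ hb)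
      omega
    have h3 := p.parts_sum
    rw [Multiset.eq_replicate_card.2 h1, Multiset.sum_replicate, smul_eq_mul, mul_one] at h3
    ext1
    rw [Multiset.eq_replicate_card.2 h1, h3]
    rfl

variable {K V : Type*} [Field K] {n d : ℕ} [AddCommGroup V] [Module K V] [FiniteDimensional K V]
  (ρ : Representation K (Equiv.Perm (Fin n)) V)

theorem inf_colorInv_partitionRep (h : d < n) {p : Nat.Partition d}
    (hp : p.parts.toFinset.card = 1) (W : Submodule K V) :
    W ⊓ colorInv ρ univ (partitionRep h.le p)
      = W ⊓ swapInv ρ (univ.filter (partitionRep h.le p · = 0))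
        ⊓ swapInv ρ (univ.filter (partitionRep h.le p · ≠ 0)) := by
  rw [inf_colorInv_eq ρ univ (partitionRep h.le p) 0 W, colorInv_of_card_image_eq_one]
  rw [image_filter_ne, image_partitionRep h, erase_insert (zero_notMem_parts p), hp]

/-- The stabilizers of the exponent vectors of degree `d` have few invariants in a space without
invariants of the symmetric group. -/
theorem sum_finrank_colorInv_le (hK : ((Fintype.card (Fin n)).factorial : K) ≠ 0) (h : d < n)
    {W : Submodule K V} (hW : SwapStable ρ univ W) (h0 : W ⊓ swapInv ρ univ = ⊥) :
    (n - 1) * ∑ p : Nat.Partition d,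
        finrank K (W ⊓ colorInv ρ univ (partitionRep h.le p) : Submodule K V)
      ≤ (∑ p : Nat.Partition d, p.parts.toFinset.card) * finrank K W := by
  by_cases h42 : n = 4 ∧ d = 2
  -- Here the partition (1, 1) gives two classes of size 2, so it is estimated jointly with (2),
  -- whose classes have sizes 3 and 1.
  · obtain ⟨rfl, rfl⟩ := h42
    rw [univ_partition_two, sum_pair (by decide), sum_pair (by decide)]
    set p₁ : Nat.Partition 2 := ⟨{2}, by simp, by simp⟩ with hp₁
    set p₂ : Nat.Partition 2 := ⟨{1, 1}, by simp, by simp⟩ with hp₂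
    have h1 : p₁.parts.toFinset.card = 1 := by decide
    have h2 : p₂.parts.toFinset.card = 1 := by decide
    have c1 := card_filter_partitionRep_eq_zero h.le p₁
    have c2 := card_filter_partitionRep_eq_zero h.le p₂
    rw [show p₁.parts.card = 1 by decide] at c1
    rw [show p₂.parts.card = 2 by decide] at c2
    have e1 := card_filter_add_card_filter_not (s := univ) (partitionRep h.le p₁ · = 0)
    have e2 := card_filter_add_card_filter_not (s := univ) (partitionRep h.le p₂ · = 0)
    rw [card_univ, Fintype.card_fin] at e1 e2
    rw [h1, h2, inf_colorInv_partitionRep ρ h h1, inf_colorInv_partitionRep ρ h h2]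
    exact finrank_two_classes_four ρ hK (disjoint_filter_filter_not _ _ _)
      (disjoint_filter_filter_not _ _ _) (filter_union_filter_not_eq _ _)
      (filter_union_filter_not_eq _ _) hW h0 c1 (by omega) c2 (by omega)
  · rw [mul_sum, sum_mul]
    refine sum_le_sum fun p _ => ?_
    have hcard := card_image_partitionRep h p
    rcases Nat.eq_zero_or_pos p.parts.toFinset.card with hk | hk
    · rw [hk, zero_add] at hcard
      rw [colorInv_of_card_image_eq_one ρ hcard, h0, finrank_bot]
      simp
    have hex : ∃ v ∈ univ.image (partitionRep h.le p),
        (univ.filter (partitionRep h.le p · = v)).card ≠ 2 := by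
      by_contra hne
      push Not at hne
      have hdeg : ∑ i, partitionRep h.le p i = d := by
        rw [← Finsupp.degree_eq_sum, degree_partitionRep]
      have := eq_four_of_card_fibers_eq_two (x := partitionRep h.le p) (by rwa [hdeg]) hne
        (by omega)
      rw [hdeg] at this
      exact h42 this
    have h1 := finrank_color_classes ρ hK (partitionRep h.le p) p.parts.toFinset.card univ W hW
      hcard hex
    rwa [h0, finrank_bot, mul_zero, mul_zero, add_zero, zero_add, card_univ, Fintype.card_fin]
      at h1

end ColorBound

/-! ### Homomorphisms out of a monomial module, and the criterion on n. -/

section Generation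

open Finset Module GroupAlgebra

set_option linter.unusedSectionVars false

variable {K : Type*} [Field K] {n d : ℕ} {V : Type*} [AddCommGroup V] [Module K V]
  [Module (MonoidAlgebra K (Equiv.Perm (Fin n))) V]
  [IsScalarTower K (MonoidAlgebra K (Equiv.Perm (Fin n))) V]
  [Invertible (Fintype.card (Equiv.Perm (Fin n)) : K)] [FiniteDimensional K V]
  {coeff : (Fin n →₀ ℕ) → V →ₗ[K] K} {mono : (Fin n →₀ ℕ) → V}

/-- Homomorphisms from a quotient of a monomial module to a module without invariants. -/
theorem finrank_hom_le_of_surjective (hV : IsMonomialModule d coeff mono)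
    (hK : ((Fintype.card (Fin n)).factorial : K) ≠ 0) (h : d < n)
    {Z U : Type*} [AddCommGroup Z] [Module K Z] [Module (MonoidAlgebra K (Equiv.Perm (Fin n))) Z]
    [IsScalarTower K (MonoidAlgebra K (Equiv.Perm (Fin n))) Z]
    [AddCommGroup U] [Module K U] [Module (MonoidAlgebra K (Equiv.Perm (Fin n))) U]
    [IsScalarTower K (MonoidAlgebra K (Equiv.Perm (Fin n))) U] [FiniteDimensional K U]
    {π : V →ₗ[MonoidAlgebra K (Equiv.Perm (Fin n))] Z} (hπ : Function.Surjective π)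
    (hU : ∀ u : U, (∀ σ : Equiv.Perm (Fin n), MonoidAlgebra.single σ (1 : K) • u = u) → u = 0) :
    (n - 1) * finrank K (Z →ₗ[MonoidAlgebra K (Equiv.Perm (Fin n))] U)
      ≤ (∑ p : Nat.Partition d, p.parts.toFinset.card) * finrank K U := by
  let ρ : Representation K (Equiv.Perm (Fin n)) U := Representation.ofModule' (k := K) U
  have hρ : ∀ (σ : Equiv.Perm (Fin n)) (u : U), ρ σ u = MonoidAlgebra.single σ (1 : K) • u :=
    fun _ _ => rfl
  have h0 : ⊤ ⊓ swapInv ρ univ = ⊥ := by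
    rw [eq_bot_iff]
    rintro u ⟨-, hu⟩
    refine hU u fun σ => ?_
    rw [← hρ]
    exact apply_eq_of_mem_swapInv ρ hu (by simp [mem_permsOn])
  have hbound := sum_finrank_colorInv_le ρ hK h (fun _ _ _ _ _ _ => Submodule.mem_top) h0
  rw [finrank_top] at hbound
  have hmono : ∀ (φ : Z →ₗ[MonoidAlgebra K (Equiv.Perm (Fin n))] U) (σ : Equiv.Perm (Fin n))
      (x : Fin n →₀ ℕ), x.degree = d →
      φ (π (mono (x.mapDomain σ))) = MonoidAlgebra.single σ (1 : K) • φ (π (mono x)) := by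
    intro φ σ x hx
    rw [← hV.single_smul_mono σ hx, map_smul, map_smul]
  -- A homomorphism is determined by the image of one monomial per orbit, and this image is fixed by
  -- the stabilizer of the monomial.
  let L : (Z →ₗ[MonoidAlgebra K (Equiv.Perm (Fin n))] U) →ₗ[K] ((p : Nat.Partition d) →
      (⊤ ⊓ colorInv ρ univ (partitionRep h.le p) : Submodule K U)) :=
    { toFun := fun φ p => ⟨φ (π (mono (partitionRep h.le p))), Submodule.mem_top, by
        intro x _ y _ hxy
        have h1 : (partitionRep h.le p).mapDomain (Equiv.swap x y) = partitionRep h.le p := by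
          ext i
          rw [mapDomain_perm_apply, Equiv.swap_inv, Equiv.swap_apply_def]
          split_ifs with h2 h3
          · rw [h2, hxy]
          · rw [h3, hxy]
          · rfl
        have h2 := hmono φ (Equiv.swap x y) _ (degree_partitionRep h.le p)
        rw [h1] at h2
        rw [hρ]
        exact h2.symm⟩
      map_add' := fun _ _ => rfl
      map_smul' := fun _ _ => rfl }
  have hL : Function.Injective L := by
    refine (injective_iff_map_eq_zero L).2 fun φ hφ => ?_
    have h1 : ∀ x : Fin n →₀ ℕ, x.degree = d → φ (π (mono x)) = 0 := by
      intro x hx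
      obtain ⟨σ, hσ⟩ := exists_perm_partitionRep h.le hx
      have h2 : φ (π (mono (partitionRep h.le (exponentPartition d x)))) = 0 :=
        congrArg Subtype.val (congrFun hφ (exponentPartition d x))
      rw [← hσ, hmono φ σ _ (degree_partitionRep h.le _), h2, smul_zero]
    ext z
    obtain ⟨v, rfl⟩ := hπ z
    rw [hV.eq_sum v, map_sum, map_sum, LinearMap.zero_apply, sum_eq_zero fun x hx => ?_]
    rw [LinearMap.map_smul_of_tower, LinearMap.map_smul_of_tower, h1 x (mem_exponents.1 hx),
      smul_zero]
  have hrank := LinearMap.finrank_le_finrank_of_injective hL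
  rw [finrank_pi_fintype] at hrank
  exact (Nat.mul_le_mul_left _ hrank).trans hbound

/-- A submodule of Z has no invariants, since an invariant vector equals its own average. Hence the
bound on homomorphisms applies to Z as the quotient of V by 1 - e. -/
theorem isRGenerated_averageZero (hV : IsMonomialModule d coeff mono)
    (hK : ((Fintype.card (Fin n)).factorial : K) ≠ 0) (hn : 1 < n) (h : d < n) {r : ℕ}
    (hr : ∑ p : Nat.Partition d, p.parts.toFinset.card ≤ r * (n - 1)) :
    IsRGenerated (MonoidAlgebra K (Equiv.Perm (Fin n))) (averageZero K n V) r := by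
  have hne : NeZero (Nat.card (Equiv.Perm (Fin n)) : K) := by
    rw [Nat.card_eq_fintype_card]
    exact ⟨Invertible.ne_zero _⟩
  have hfin : FiniteDimensional K (averageZero K n V) :=
    inferInstanceAs (FiniteDimensional K ((averageZero K n V).restrictScalars K))
  refine isRGenerated_of_finrank_hom_le (K := K) r fun W _ => ?_
  have hfinW : FiniteDimensional K W :=
    inferInstanceAs (FiniteDimensional K (W.restrictScalars K))
  let π : V →ₗ[MonoidAlgebra K (Equiv.Perm (Fin n))] averageZero K n V :=
    (LinearMap.id - centralMul V (average K (Equiv.Perm (Fin n)))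
      (mul_average_comm K _)).codRestrict (averageZero K n V) fun v => by
        change average K (Equiv.Perm (Fin n)) • (v - average K (Equiv.Perm (Fin n)) • v) = 0
        rw [smul_sub, smul_smul, average_mul_average, sub_self]
  have hπ : Function.Surjective π := by
    refine fun z => ⟨z, Subtype.ext ?_⟩
    change (z : V) - average K (Equiv.Perm (Fin n)) • (z : V) = z
    rw [show average K (Equiv.Perm (Fin n)) • (z : V) = 0 from z.2, sub_zero]
  have h1 := finrank_hom_le_of_surjective hV hK h hπ (U := W) fun w hw => by
    apply Subtype.ext
    apply Subtype.ext
    have h2 : average K (Equiv.Perm (Fin n)) • ((w : averageZero K n V) : V) = _ :=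
      average_smul_of_invariant K fun σ =>
        congrArg (fun u : W => ((u : averageZero K n V) : V)) (hw σ)
    exact h2.symm.trans (w : averageZero K n V).2
  refine le_of_mul_le_mul_left (?_ : (n - 1) * _ ≤ (n - 1) * _) (by omega)
  refine (h1.trans (Nat.mul_le_mul_right _ hr)).trans_eq ?_
  ring

/-- The dimension formula for maximal `r`-generated submodules of a monomial module. -/
theorem finrank_maximal_iff_sum_le (hV : IsMonomialModule d coeff mono)
    (hK : ((Fintype.card (Fin n)).factorial : K) ≠ 0) (hn : 1 < n) (h : d < n) {r : ℕ}
    (hr : r ≤ numPartitions d) {M : Submodule (MonoidAlgebra K (Equiv.Perm (Fin n))) V}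
    (hM : IsMaximalRGenerated r M) :
    (finrank K M : ℤ) = (finrank K V : ℤ) - ((numPartitions d : ℤ) - (r : ℤ)) ↔
      ∑ i ∈ range d, numPartitions i ≤ r * (n - 1) := by
  rw [← finrank_symmInvariants hV h.le] at hr ⊢
  rw [finrank_maximal_iff (average_mul_average K) (exists_mul_average_eq K _) hM hr,
    ← sum_card_toFinset_parts]
  exact ⟨sum_card_parts_le_of_isRGenerated hV h, isRGenerated_averageZero hV hK hn h⟩

end Generation

/-! ### Homogeneous polynomials as a monomial module. -/

section HomogeneousPart

open Finset Module

variable (K : Type*) [Field K] {n d : ℕ}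

instance finiteDimensional_homogPart : FiniteDimensional K (HomogPart K n d) :=
  have : Module.Finite K (MvPolynomial.homogeneousSubmodule (Fin n) K d) :=
    Module.Finite.iff_fg.2 (MvPolynomial.homogeneousSubmodule_fg _ _ d)
  inferInstanceAs (Module.Finite K (homogRep K n d).asModule)

/-- The coefficient of a monomial, as a linear form on the homogeneous part. -/
noncomputable def homogCoeff (d : ℕ) (x : Fin n →₀ ℕ) : HomogPart K n d →ₗ[K] K :=
  (MvPolynomial.lcoeff K x).comp ((MvPolynomial.homogeneousSubmodule (Fin n) K d).subtype.comp
    (homogRep K n d).asModuleEquiv.toLinearMap)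

theorem homogCoeff_apply (x : Fin n →₀ ℕ) (v : HomogPart K n d) :
    homogCoeff K d x v = (((homogRep K n d).asModuleEquiv v).1).coeff x := rfl

/-- A monomial as an element of the homogeneous part (zero if the degree is wrong). -/
noncomputable def homogMonomial (d : ℕ) (x : Fin n →₀ ℕ) : HomogPart K n d :=
  (homogRep K n d).asModuleEquiv.symm
    (if h : x.degree = d then ⟨MvPolynomial.monomial x 1, MvPolynomial.isHomogeneous_monomial 1 h⟩
      else 0)

theorem homogCoeff_homogMonomial {x : Fin n →₀ ℕ} (hx : x.degree = d) (y : Fin n →₀ ℕ) :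
    homogCoeff K d y (homogMonomial K d x) = if x = y then 1 else 0 := by
  rw [homogCoeff_apply, homogMonomial, dif_pos hx, LinearEquiv.apply_symm_apply,
    MvPolynomial.coeff_monomial]

theorem homogPart_ext {v w : HomogPart K n d}
    (h : ∀ x : Fin n →₀ ℕ, x.degree = d → homogCoeff K d x v = homogCoeff K d x w) : v = w := by
  apply (homogRep K n d).asModuleEquiv.injective
  apply Subtype.ext
  ext x
  by_cases hx : x.degree = d
  · exact h x hx
  · have h1 := ((homogRep K n d).asModuleEquiv v).2
    have h2 := ((homogRep K n d).asModuleEquiv w).2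
    rw [MvPolynomial.IsHomogeneous.coeff_eq_zero h1 hx,
      MvPolynomial.IsHomogeneous.coeff_eq_zero h2 hx]

theorem homogCoeff_smul (σ : Equiv.Perm (Fin n)) (x : Fin n →₀ ℕ) (v : HomogPart K n d) :
    homogCoeff K d (x.mapDomain σ) (MonoidAlgebra.single σ (1 : K) • v) = homogCoeff K d x v := by
  rw [homogCoeff_apply, homogCoeff_apply, Representation.asModuleEquiv_map_smul,
    Representation.asAlgebraHom_single_one]
  exact MvPolynomial.coeff_rename_mapDomain σ σ.injective _ x

theorem isMonomialModule_homogPart :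
    IsMonomialModule d (homogCoeff (n := n) K d) (homogMonomial K d) where
  coeff_mono _ hx := homogCoeff_homogMonomial K hx
  ext _ _ := homogPart_ext K
  coeff_smul := homogCoeff_smul K

end HomogeneousPart

theorem natCast_factorial_ne_zero {K : Type*} [Field K] {n : ℕ}
    (h : ringChar K = 0 ∨ n < ringChar K) : (n.factorial : K) ≠ 0 := by
  rw [Ne, ringChar.spec]
  rcases h with h | h
  · rw [h, zero_dvd_iff]
    exact n.factorial_ne_zero
  · have hp : (ringChar K).Prime :=
      (CharP.char_is_prime_or_zero K (ringChar K)).resolve_right (by omega)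
    rw [hp.dvd_factorial]
    omega

theorem mainTheorem4 (K : Type*) [Field K] [Infinite K] (n d r : ℕ) (hn : 1 < n)
    (hchar : ringChar K = 0 ∨ n < ringChar K)
    (hr : 1 ≤ r) (hrP : r ≤ numPartitions d) (hnd : d < n)
    (M : Submodule (MonoidAlgebra K (Equiv.Perm (Fin n))) (HomogPart K n d))
    (hM : IsMaximalRGenerated r M) :
    (Module.finrank K M : ℤ) =
        (Module.finrank K (HomogPart K n d) : ℤ) - ((numPartitions d : ℤ) - (r : ℤ)) ↔
      (n : ℚ) ≥ 1 + (∑ i ∈ Finset.range d, (numPartitions i : ℚ)) / (r : ℚ) := by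
  have hK : ((Fintype.card (Fin n)).factorial : K) ≠ 0 := by
    rw [Fintype.card_fin]
    exact natCast_factorial_ne_zero hchar
  let _ : Invertible (Fintype.card (Equiv.Perm (Fin n)) : K) :=
    invertibleOfNonzero (by rwa [Fintype.card_perm])
  refine (finrank_maximal_iff_sum_le (V := HomogPart K n d) (isMonomialModule_homogPart K) hK hn
    hnd hrP hM).trans ?_
  have hr0 : (0 : ℚ) < r := by exact_mod_cast hr
  -- The truncated n - 1 is the true difference because n > 1, and clearing the positive denominator
  -- r gives the integral inequality.
  have hn1 : (n : ℚ) - 1 = ((n - 1 : ℕ) : ℚ) := by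
    rw [Nat.cast_sub hn.le, Nat.cast_one]
  rw [ge_iff_le, ← le_sub_iff_add_le', div_le_iff₀ hr0, hn1, mul_comm, ← Nat.cast_sum,
    ← Nat.cast_mul, Nat.cast_le]
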